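/- **Theorem.** Let $a:[0,\infty)\to[0,\infty)$ be differentiable and non-increasing with $\lim_{t\to\infty}a(t)=0$, and assume that there is $c>0$ with $a(t)\ge \frac{c}{t+1}$ for all $t\ge 0$. Let $G:\mathbb{R}\to\mathbb{R}$ be of class $\mathcal{C}^1$ and coercive ($G(\xi)\to\infty$ as $|\xi|\to\infty$), with $G'$ Lipschitz continuous on bounded sets. Assume moreover: (a) $G$ has finitely many critical points; (b) $G$ takes different values at different critical points; (c) near each critical point $x^*$, $G$ is either strongly convex or strongly concave. Here $G$ is strongly convex near $x^*$ if there are $\varepsilon,\delta>0$ such that $G(y)\ge G(x)+(y-x)G'(x)+\delta(y-x)^2$ for all $x,y\in(x^*-\varepsilon,x^*+\varepsilon)$, and strongly concave near $x^*$ if $-G$ is strongly convex near $x^*$. Then for every $(x_0,x_1)\in\mathbb{R}^2$ the problem $$\ddot x(t)+a(t)\,\dot x(t)+G'(x(t))=0\quad (t\ge 0),\qquad x(0)=x_0,\quad \dot x(0)=x_1,$$ has a unique solution $x\in\mathcal{C}^2([0,\infty))$, and the set of initial data $(x_0,x_1)\in\mathbb{R}^2$ for which $\lim_{t\to\infty}x(t)$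 exists and is a local minimum point of $G$ is open and dense in $\mathbb{R}^2$. -/

import Mathlib

/-!
The energy `E = x'² / 2 + G(x)` decreases along a solution, hence tends to some level `e`. Suppose
that the velocity does not tend to `0`. Since `a(t) ≥ c / (t + 1)`, a time `s` at which the speed
exceeds a fixed threshold costs an energy of order `1 / s`. Between such times `G(x)` is close to
`e`, so `x` stays near one point of the level set `G = e`. A noncritical point is left within a
bounded time, and near a strict minimum the motion is trapped and comes to rest. Near a
nondegenerate maximum, `x'² / 2 ≥ (E - e) + δ (x - c)²` bounds the passage time by an `arsinh`,
that is by `O(1 + log (1 + 1 / (E - e)))`. As `E - e` is at least of order `1 / s`, these waiting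
times are `O(log s)`, so the losses add up like the divergent series `∑ 1 / (n log n)`: a
contradiction. Hence `G(x)` converges, and `x` converges to a critical point because the points of
a level set of `G` are isolated.

Near a minimum the well of `G` traps all neighbouring solutions, which gives openness. For density,
let `z` be the difference of two solutions that stay near the same maximum. Strong concavity makes
`z z'` nondecreasing, and if it is positive at some time then `z` is unbounded. So the initial data
whose solutions stay near a maximum from a given late time on form a closed set without interior,
and Baire's theorem applies.
-/

open Set Filter Topology

/-- `G` is strongly convex in the neighbourhood of `c`: for some `ε, δ > 0`,
`G y ≥ G x + (y - x) G'(x) + δ (y - x)²` for all `x, y` in `]c - ε, c + ε[`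
(used for `G` of class `C¹`). -/
def StronglyConvexNear (G : ℝ → ℝ) (c : ℝ) : Prop :=
  ∃ ε > 0, ∃ δ > 0, ∀ x ∈ Ioo (c - ε) (c + ε), ∀ y ∈ Ioo (c - ε) (c + ε),
    G x + (y - x) * deriv G x + δ * (y - x) ^ 2 ≤ G y

/-- `G` is strongly concave in the neighbourhood of `c`: `-G` is strongly convex there. -/
def StronglyConcaveNear (G : ℝ → ℝ) (c : ℝ) : Prop :=
  StronglyConvexNear (fun x => -G x) c

/-- `x` restricts to a `C²` solution on `[0, ∞)` of `x'' + a(t) x' + G'(x) = 0` with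
`x(0) = p.1` and `x'(0) = p.2`. Derivatives are taken within `[0, ∞)`, hence are one-sided at `0`,
and the values of `x` at negative times play no role. -/
structure IsSolutionFrom (a G : ℝ → ℝ) (p : ℝ × ℝ) (x : ℝ → ℝ) : Prop where
  contDiffOn : ContDiffOn ℝ 2 x (Ici 0)
  equation : ∀ t, 0 ≤ t →
    derivWithin (derivWithin x (Ici 0)) (Ici 0) t + a t * derivWithin x (Ici 0) t
      + deriv G (x t) = 0
  initial_position : x 0 = p.1
  initial_velocity : derivWithin x (Ici 0) 0 = p.2

/-- The initial data `(x₀, x₁)` whose solution converges, as `t → ∞`, to a local minimum of `G`. -/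
def dataConvergingToLocalMin (a G : ℝ → ℝ) : Set (ℝ × ℝ) :=
  {p | ∃ x, IsSolutionFrom a G p x ∧ ∃ m, IsLocalMin G m ∧ Tendsto x atTop (𝓝 m)}

section IntegralCurves

open Metric

variable {E : Type*} [NormedAddCommGroup E] [NormedSpace ℝ E] {f : ℝ → E → E} {γ η : ℝ → E}
  {I : Set ℝ} {K : NNReal} {s t : ℝ}

theorem isIntegralCurveOn_comp_neg (hγ : IsIntegralCurveOn γ f I) :
    IsIntegralCurveOn (fun t => γ (-t)) (fun t => -f (-t)) (-I) := by
  simpa [IsIntegralCurveOn, Function.comp_def] using! hγ.comp_mul (-1)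

theorem hasDerivWithinAt_Ici_of_isIntegralCurveOn (hI : I.OrdConnected)
    (hγ : IsIntegralCurveOn γ f I) (hs : s ∈ I) (ht : t ∈ I) (hst : s < t) :
    HasDerivWithinAt γ (f s (γ s)) (Ici s) s :=
  ((hγ s hs).mono (hI.out hs ht)).mono_of_mem_nhdsWithin (Icc_mem_nhdsGE hst)

theorem dist_le_mul_exp_of_isIntegralCurveOn_of_le {S : ℝ → Set E} (hI : I.OrdConnected)
    (hf : ∀ t ∈ I, LipschitzOnWith K (f t) (S t)) (hγ : IsIntegralCurveOn γ f I)
    (hη : IsIntegralCurveOn η f I) (hγS : ∀ t ∈ I, γ t ∈ S t) (hηS : ∀ t ∈ I, η t ∈ S t)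
    (hs : s ∈ I) (ht : t ∈ I) (hst : s ≤ t) :
    dist (γ t) (η t) ≤ dist (γ s) (η s) * Real.exp (K * (t - s)) := by
  have hsub : Icc s t ⊆ I := hI.out hs ht
  have hsub' : Ico s t ⊆ I := Ico_subset_Icc_self.trans hsub
  exact dist_le_of_trajectories_ODE_of_mem (fun r hr => hf r (hsub' hr))
    (hγ.continuousOn.mono hsub)
    (fun r hr => hasDerivWithinAt_Ici_of_isIntegralCurveOn hI hγ (hsub' hr) ht hr.2)
    (fun r hr => hγS r (hsub' hr)) (hη.continuousOn.mono hsub)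
    (fun r hr => hasDerivWithinAt_Ici_of_isIntegralCurveOn hI hη (hsub' hr) ht hr.2)
    (fun r hr => hηS r (hsub' hr)) le_rfl t (right_mem_Icc.2 hst)

theorem dist_le_mul_exp_of_isIntegralCurveOn {S : ℝ → Set E} (hI : I.OrdConnected)
    (hf : ∀ t ∈ I, LipschitzOnWith K (f t) (S t)) (hγ : IsIntegralCurveOn γ f I)
    (hη : IsIntegralCurveOn η f I) (hγS : ∀ t ∈ I, γ t ∈ S t) (hηS : ∀ t ∈ I, η t ∈ S t)
    (hs : s ∈ I) (ht : t ∈ I) :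
    dist (γ t) (η t) ≤ dist (γ s) (η s) * Real.exp (K * |t - s|) := by
  rcases le_total s t with hst | hts
  · rw [abs_of_nonneg (sub_nonneg.2 hst)]
    exact dist_le_mul_exp_of_isIntegralCurveOn_of_le hI hf hγ hη hγS hηS hs ht hst
  · have hrev := dist_le_mul_exp_of_isIntegralCurveOn_of_le (s := -s) (t := -t)
      (S := fun t => S (-t)) (hI.preimage_anti fun _ _ => neg_le_neg)
      (fun t ht => (hf (-t) ht).neg) (isIntegralCurveOn_comp_neg hγ)
      (isIntegralCurveOn_comp_neg hη) (fun t ht => hγS (-t) ht) (fun t ht => hηS (-t) ht)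
      (by simpa using hs) (by simpa using ht) (neg_le_neg hts)
    rw [abs_of_nonpos (sub_nonpos.2 hts)]
    simpa only [neg_neg, neg_sub, sub_neg_eq_add, neg_add_eq_sub] using hrev

theorem eqOn_of_isIntegralCurveOn {S : ℝ → Set E} (hI : I.OrdConnected)
    (hf : ∀ t ∈ I, LipschitzOnWith K (f t) (S t)) (hγ : IsIntegralCurveOn γ f I)
    (hη : IsIntegralCurveOn η f I) (hγS : ∀ t ∈ I, γ t ∈ S t) (hηS : ∀ t ∈ I, η t ∈ S t)
    (hs : s ∈ I) (heq : γ s = η s) : EqOn γ η I := fun t ht => by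
  have hdist := dist_le_mul_exp_of_isIntegralCurveOn hI hf hγ hη hγS hηS hs ht
  rwa [heq, dist_self, zero_mul, dist_le_zero] at hdist

theorem exists_isIntegralCurve_of_eqOn_ball {g : ℕ → ℝ → E}
    (hg : ∀ n : ℕ, IsIntegralCurveOn (g n) f (ball s n))
    (hgg : ∀ m n : ℕ, m ≤ n → EqOn (g m) (g n) (ball s m)) :
    ∃ γ, IsIntegralCurve γ f ∧ ∀ n : ℕ, EqOn γ (g n) (ball s n) := by
  let γ : ℝ → E := fun t => g (⌊dist t s⌋₊ + 1) t
  have hγg (n : ℕ) : EqOn γ (g n) (ball s n) := by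
    intro t ht
    have ht' : t ∈ ball s (⌊dist t s⌋₊ + 1 : ℕ) := by
      simpa using Nat.lt_floor_add_one (dist t s)
    rcases le_total (⌊dist t s⌋₊ + 1) n with h | h
    · exact hgg _ _ h ht'
    · exact (hgg _ _ h ht).symm
  refine ⟨γ, fun t => ?_, hγg⟩
  obtain ⟨n, hn⟩ := exists_nat_gt (dist t s)
  have hball : ball s (n : ℝ) ∈ 𝓝 t := isOpen_ball.mem_nhds hn
  rw [hγg n hn]
  exact ((hg n t hn).hasDerivAt hball).congr_of_eventuallyEq ((hγg n).eventuallyEq_of_mem hball)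

theorem exists_isIntegralCurve_of_lipschitzWith_of_bounded [CompleteSpace E] {L : NNReal}
    (hlip : ∀ t, LipschitzWith K (f t)) (hcont : ∀ w, Continuous fun t => f t w)
    (hbdd : ∀ t w, ‖f t w‖ ≤ L) (s : ℝ) (w : E) :
    ∃ γ, γ s = w ∧ IsIntegralCurve γ f := by
  have local_solution (n : ℕ) : ∃ γ, γ s = w ∧ IsIntegralCurveOn γ f (ball s n) := by
    have hPL : IsPicardLindelof f (tmin := s - n) (tmax := s + n)
        ⟨s, by simp⟩ w (L * n) 0 L K :=
      { lipschitzOnWith := fun t _ => (hlip t).lipschitzOnWith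
        continuousOn := fun w _ => (hcont w).continuousOn
        norm_le := fun t _ w _ => hbdd t w
        mul_max_le := by simp }
    obtain ⟨γ, hγs, hγ⟩ := hPL.exists_eq_forall_mem_Icc_hasDerivWithinAt₀
    have hsub : ball s n ⊆ Icc (s - n) (s + n) :=
      ball_subset_closedBall.trans Real.closedBall_eq_Icc.subset
    exact ⟨γ, hγs, fun t ht => (hγ t (hsub ht)).mono hsub⟩
  choose g hgs hg using local_solution
  have hgg (m n : ℕ) (hmn : m ≤ n) : EqOn (g m) (g n) (ball s m) := by
    intro t ht
    have hs : s ∈ ball s (m : ℝ) := mem_ball_self (pos_of_mem_ball ht)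
    exact eqOn_of_isIntegralCurveOn (S := fun _ => univ) (convex_ball s (m : ℝ)).ordConnected
      (fun t _ => (hlip t).lipschitzOnWith) (hg m)
      ((hg n).mono (ball_subset_ball (Nat.cast_le.2 hmn))) (fun _ _ => trivial)
      (fun _ _ => trivial) hs (by rw [hgs, hgs]) ht
  obtain ⟨γ, hγ, hγg⟩ := exists_isIntegralCurve_of_eqOn_ball hg hgg
  exact ⟨γ, by rw [hγg 1 (by simp), hgs], hγ⟩

theorem lt_of_forall_uIoo_lt {g : ℝ → ℝ} {R : ℝ} (hI : I.OrdConnected) (hg : ContinuousOn g I)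
    (hs : s ∈ I) (hstep : ∀ t ∈ I, (∀ r ∈ uIoo s t, g r < R) → g t < R) :
    ∀ t ∈ I, g t < R := by
  by_contra! hfail
  obtain ⟨t, ht, hgt⟩ := hfail
  have hsub : uIcc s t ⊆ I := hI.uIcc_subset hs ht
  have hcompact : IsCompact {r ∈ uIcc s t | R ≤ g r} :=
    isCompact_uIcc.of_isClosed_subset
      ((hg.mono hsub).preimage_isClosed_of_isClosed isClosed_Icc isClosed_Ici) (sep_subset _ _)
  obtain ⟨r, ⟨hr, hgr⟩, hmin⟩ := hcompact.exists_isMinOn ⟨t, right_mem_uIcc, hgt⟩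
    (f := fun r => |r - s|) (by fun_prop)
  refine (hstep r (hsub hr) fun q hq => ?_).not_ge hgr
  by_contra! hgq
  have hqt : q ∈ uIcc s t := uIcc_subset_uIcc_left hr (uIoo_subset_uIcc_self hq)
  have hlt : |q - s| < |r - s| := by
    rcases le_total s r with hsr | hsr
    · rw [uIoo_of_le hsr] at hq
      rw [abs_of_pos (sub_pos.2 hq.1), abs_of_nonneg (sub_nonneg.2 hsr)]
      linarith [hq.2]
    · rw [uIoo_of_ge hsr] at hq
      rw [abs_of_neg (sub_neg.2 hq.2), abs_of_nonpos (sub_nonpos.2 hsr)]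
      linarith [hq.1]
  exact hlt.not_ge (hmin ⟨hqt, hgq⟩)

end IntegralCurves

section PhaseSpace

variable {a G : ℝ → ℝ} {γ : ℝ → ℝ × ℝ} {s t : ℝ}

/-- The time-dependent vector field on phase space for which `t ↦ (x t, x' t)` is an integral curve
if and only if `x'' + a(t) x' + G'(x) = 0`. -/
noncomputable def dampedField (a G : ℝ → ℝ) (t : ℝ) (w : ℝ × ℝ) : ℝ × ℝ :=
  (w.2, -(a t * w.2) - deriv G w.1)

/-- A curve in phase space solving the damped equation on `[0, ∞)`; its values at negative times
play no role. -/
def IsTrajectory (a G : ℝ → ℝ) (γ : ℝ → ℝ × ℝ) : Prop :=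
  IsIntegralCurveOn γ (dampedField a G) (Ici 0)

/-- The mechanical energy, kinetic plus potential, of the state `w = (position, velocity)`. -/
noncomputable def energy (G : ℝ → ℝ) (w : ℝ × ℝ) : ℝ := w.2 ^ 2 / 2 + G w.1

/-- The assumptions on the damping `a` and the potential `G` under which the initial value problem
is globally well posed on `[0, ∞)`. -/
structure DampedSystem (a G : ℝ → ℝ) : Prop where
  continuousOn : ContinuousOn a (Ici 0)
  nonneg : ∀ t, 0 ≤ t → 0 ≤ a t
  bounded : ∃ A, ∀ t, 0 ≤ t → a t ≤ A
  contDiff : ContDiff ℝ 1 G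
  coercive : Tendsto G (cocompact ℝ) atTop
  lipschitz : ∀ s : Set ℝ, Bornology.IsBounded s → ∃ K, LipschitzOnWith K (deriv G) s

theorem le_energy (G : ℝ → ℝ) (w : ℝ × ℝ) : G w.1 ≤ energy G w := by
  unfold energy
  linarith [sq_nonneg w.2]

theorem hasDerivWithinAt_energy {D : Set ℝ} (hG : DifferentiableAt ℝ G (γ t).1)
    (hγ : HasDerivWithinAt γ (dampedField a G t (γ t)) D t) :
    HasDerivWithinAt (fun r => energy G (γ r)) (-(a t * (γ t).2 ^ 2)) D t := by
  have hfst : HasDerivWithinAt (fun r => (γ r).1) (γ t).2 D t := hγ.fst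
  have hsnd : HasDerivWithinAt (fun r => (γ r).2) (-(a t * (γ t).2) - deriv G (γ t).1) D t :=
    hγ.snd
  have hpotential := hG.hasDerivAt.comp_hasDerivWithinAt t hfst
  refine (((hsnd.pow 2).div_const 2).add hpotential).congr_deriv ?_
  push_cast
  ring

namespace IsTrajectory

theorem continuousOn (hγ : IsTrajectory a G γ) : ContinuousOn γ (Ici 0) :=
  IsIntegralCurveOn.continuousOn hγ

theorem hasDerivAt_fst (hγ : IsTrajectory a G γ) (ht : 0 < t) :
    HasDerivAt (fun r => (γ r).1) (γ t).2 t :=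
  ((hγ t ht.le).hasDerivAt (Ici_mem_nhds ht)).fst

theorem hasDerivAt_snd (hγ : IsTrajectory a G γ) (ht : 0 < t) :
    HasDerivAt (fun r => (γ r).2) (-(a t * (γ t).2) - deriv G (γ t).1) t :=
  ((hγ t ht.le).hasDerivAt (Ici_mem_nhds ht)).snd

end IsTrajectory

namespace DampedSystem

theorem differentiable (h : DampedSystem a G) : Differentiable ℝ G :=
  h.contDiff.differentiable one_ne_zero

theorem continuous_deriv (h : DampedSystem a G) : Continuous (deriv G) :=
  h.contDiff.continuous_deriv le_rfl

theorem exists_forall_le (h : DampedSystem a G) : ∃ m, ∀ y, m ≤ G y :=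
  let ⟨y, hy⟩ := h.contDiff.continuous.exists_forall_le h.coercive
  ⟨G y, hy⟩

theorem continuous_energy (h : DampedSystem a G) : Continuous (energy G) :=
  ((continuous_snd.pow 2).div_const 2).add (h.contDiff.continuous.comp continuous_fst)

theorem tendsto_energy_cobounded (h : DampedSystem a G) :
    Tendsto (energy G) (Bornology.cobounded (ℝ × ℝ)) atTop := by
  obtain ⟨m, hm⟩ := h.exists_forall_le
  have hsq : Tendsto (fun u : ℝ => u ^ 2 / 2) (Bornology.cobounded ℝ) atTop := by
    simpa only [Real.norm_eq_abs, sq_abs, Function.comp_def] using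
      ((tendsto_pow_atTop two_ne_zero).comp (tendsto_norm_cobounded_atTop (E := ℝ))).atTop_div_const
        (zero_lt_two' ℝ)
  rw [Bornology.cobounded_prod, Filter.coprod, tendsto_sup]
  exact ⟨tendsto_atTop_add_left_of_le _ 0 (fun w => by positivity)
      ((Metric.cobounded_eq_cocompact (α := ℝ) ▸ h.coercive).comp tendsto_comap),
    tendsto_atTop_add_right_of_le _ m (hsq.comp tendsto_comap) fun w => hm w.1⟩

theorem exists_norm_lt_of_energy_le (h : DampedSystem a G) (e : ℝ) :
    ∃ R > 0, ∀ w, energy G w ≤ e → ‖w‖ < R := by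
  have hbounded : Bornology.IsBounded {w | energy G w ≤ e} :=
    Bornology.isBounded_def.2 <| mem_of_superset
      (h.tendsto_energy_cobounded.eventually_gt_atTop e) fun w hw => by simpa using hw
  obtain ⟨R, hR, hball⟩ := hbounded.subset_ball_lt 0 0
  exact ⟨R, hR, fun w hw => mem_ball_zero_iff.1 (hball hw)⟩

section Energy

variable {D : Set ℝ}

theorem antitoneOn_energy (h : DampedSystem a G) (hD : Convex ℝ D) (hD0 : D ⊆ Ici 0)
    (hcont : ContinuousOn γ D) (hγ : IsIntegralCurveOn γ (dampedField a G) (interior D)) :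
    AntitoneOn (fun t => energy G (γ t)) D :=
  antitoneOn_of_hasDerivWithinAt_nonpos hD (h.continuous_energy.comp_continuousOn hcont)
    (fun t ht => hasDerivWithinAt_energy (h.differentiable _) (hγ t ht)) fun t ht =>
      neg_nonpos.2 (mul_nonneg (h.nonneg t (hD0 (interior_subset ht))) (sq_nonneg _))

theorem monotoneOn_energy_sub_mul_exp (h : DampedSystem a G) {A m : ℝ}
    (hA : ∀ t, 0 ≤ t → a t ≤ A) (hm : ∀ y, m ≤ G y) (hD : Convex ℝ D) (hD0 : D ⊆ Ici 0)
    (hcont : ContinuousOn γ D) (hγ : IsIntegralCurveOn γ (dampedField a G) (interior D)) :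
    MonotoneOn (fun t => (energy G (γ t) - m) * Real.exp (2 * A * t)) D := by
  refine monotoneOn_of_hasDerivWithinAt_nonneg hD
    (((h.continuous_energy.comp_continuousOn hcont).sub continuousOn_const).mul (by fun_prop))
    (fun t ht => ((hasDerivWithinAt_energy (h.differentiable _) (hγ t ht)).sub_const m).mul
      ((hasDerivAt_id t).const_mul (2 * A)).exp.hasDerivWithinAt) fun t ht => ?_
  have ht0 : 0 ≤ t := hD0 (interior_subset ht)
  have hpotential : 0 ≤ A * (G (γ t).1 - m) :=
    mul_nonneg ((h.nonneg t ht0).trans (hA t ht0)) (sub_nonneg.2 (hm _))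
  have hkinetic : 0 ≤ (A - a t) * (γ t).2 ^ 2 :=
    mul_nonneg (sub_nonneg.2 (hA t ht0)) (sq_nonneg _)
  calc 0 ≤ ((A - a t) * (γ t).2 ^ 2 + 2 * (A * (G (γ t).1 - m))) * Real.exp (2 * A * t) := by
        positivity
    _ = _ := by simp only [energy, id, mul_one]; ring

theorem exists_energy_le (h : DampedSystem a G) (s e : ℝ) : ∃ e', ∀ t γ, 0 ≤ s → 0 ≤ t →
    ContinuousOn γ (uIcc s t) → IsIntegralCurveOn γ (dampedField a G) (uIoo s t) →
      energy G (γ s) ≤ e → energy G (γ t) ≤ e' := by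
  obtain ⟨A, hA⟩ := h.bounded
  obtain ⟨m, hm⟩ := h.exists_forall_le
  refine ⟨m + (e - m) * Real.exp (2 * A * s), fun t γ hs ht hcont hγ he => ?_⟩
  have hA0 : 0 ≤ A := (h.nonneg 0 le_rfl).trans (hA 0 le_rfl)
  have hD0 : uIcc s t ⊆ Ici 0 := (ordConnected_Ici (a := (0 : ℝ))).uIcc_subset hs ht
  have hγ' : IsIntegralCurveOn γ (dampedField a G) (interior (uIcc s t)) := by
    rwa [uIcc, interior_Icc]
  have hpos (r : ℝ) : 0 ≤ energy G (γ r) - m := sub_nonneg.2 ((hm _).trans (le_energy G _))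
  have hs_le : (energy G (γ s) - m) * Real.exp (2 * A * s) ≤ (e - m) * Real.exp (2 * A * s) := by
    gcongr
  rcases le_total s t with hst | hts
  · have hE := h.antitoneOn_energy (convex_uIcc s t) hD0 hcont hγ' left_mem_uIcc right_mem_uIcc hst
    have hexp := le_mul_of_one_le_right (hpos s)
      (Real.one_le_exp (show 0 ≤ 2 * A * s by positivity))
    simp only at hE
    linarith
  · have hE := h.monotoneOn_energy_sub_mul_exp hA hm (convex_uIcc s t) hD0 hcont hγ'
      right_mem_uIcc left_mem_uIcc hts
    have hexp := le_mul_of_one_le_right (hpos t)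
      (Real.one_le_exp (show 0 ≤ 2 * A * t by positivity))
    simp only at hE
    linarith

end Energy

end DampedSystem

end PhaseSpace

section WellPosedness

open Metric

variable {a G : ℝ → ℝ} {γ η : ℝ → ℝ × ℝ} {s t : ℝ}

theorem exists_lipschitzWith_retraction_closedBall {R : ℝ} (hR : 0 ≤ R) :
    ∃ ρ : ℝ × ℝ → ℝ × ℝ, LipschitzWith 1 ρ ∧ (∀ w, ρ w ∈ closedBall 0 R) ∧
      ∀ w ∈ closedBall 0 R, ρ w = w := by
  let clamp : ℝ → ℝ := fun y => max (-R) (min y R)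
  have hclamp : LipschitzWith 1 clamp := (LipschitzWith.id.min_const R).const_max (-R)
  have hmem (y : ℝ) : |clamp y| ≤ R :=
    abs_le.2 ⟨le_max_left _ _, max_le (by linarith) (min_le_right _ _)⟩
  have hfix {y : ℝ} (hy : |y| ≤ R) : clamp y = y := by
    simp [clamp, (abs_le.1 hy).1, (abs_le.1 hy).2]
  refine ⟨fun w => (clamp w.1, clamp w.2), ?_, fun w => ?_, fun w hw => ?_⟩
  · simpa only [mul_one, max_self] using!
      (hclamp.comp LipschitzWith.prod_fst).prodMk (hclamp.comp LipschitzWith.prod_snd)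
  · simpa [Prod.norm_def] using ⟨hmem w.1, hmem w.2⟩
  · have hw' : |w.1| ≤ R ∧ |w.2| ≤ R := by simpa [Prod.norm_def] using hw
    exact Prod.ext (hfix hw'.1) (hfix hw'.2)

namespace DampedSystem

theorem exists_lipschitzOnWith_dampedField (h : DampedSystem a G) (R : ℝ) :
    ∃ K : NNReal, ∀ t, 0 ≤ t → LipschitzOnWith K (dampedField a G t) (closedBall 0 R) := by
  obtain ⟨A, hA⟩ := h.bounded
  obtain ⟨K, hK⟩ := h.lipschitz (closedBall 0 R) isBounded_closedBall
  have hfst : MapsTo Prod.fst (closedBall (0 : ℝ × ℝ) R) (closedBall 0 R) := fun w hw =>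
    mem_closedBall_zero_iff.2 ((norm_fst_le w).trans (mem_closedBall_zero_iff.1 hw))
  refine ⟨max 1 (A.toNNReal + K), fun t ht => ?_⟩
  have hdamping : LipschitzWith A.toNNReal fun w : ℝ × ℝ => a t * w.2 := by
    refine ((lipschitzWith_smul (a t)).comp LipschitzWith.prod_snd).weaken ?_
    rw [mul_one, ← NNReal.coe_le_coe, coe_nnnorm, Real.norm_of_nonneg (h.nonneg t ht)]
    exact (hA t ht).trans (Real.le_coe_toNNReal A)
  have hforce : LipschitzOnWith K (fun w : ℝ × ℝ => deriv G w.1) (closedBall 0 R) := by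
    simpa only [mul_one] using! hK.comp LipschitzWith.prod_fst.lipschitzOnWith hfst
  exact LipschitzWith.prod_snd.lipschitzOnWith.prodMk (hdamping.neg.lipschitzOnWith.sub hforce)

theorem continuous_dampedField_max (h : DampedSystem a G) (w : ℝ × ℝ) :
    Continuous fun t => dampedField a G (max t 0) w := by
  have ha : Continuous fun t => a (max t 0) :=
    h.continuousOn.comp_continuous (by fun_prop) fun t => le_max_right t 0
  exact continuous_const.prodMk ((ha.mul continuous_const).neg.sub continuous_const)

theorem exists_solution_of_truncation (h : DampedSystem a G) {R : ℝ} (hR : 0 ≤ R) (s : ℝ)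
    (w : ℝ × ℝ) : ∃ γ, γ s = w ∧ Continuous γ ∧
      ∀ t, 0 ≤ t → ‖γ t‖ ≤ R → HasDerivAt γ (dampedField a G t (γ t)) t := by
  obtain ⟨K, hK⟩ := h.exists_lipschitzOnWith_dampedField R
  obtain ⟨ρ, hρ, hρ_mem, hρ_fix⟩ := exists_lipschitzWith_retraction_closedBall hR
  let f : ℝ → ℝ × ℝ → ℝ × ℝ := fun t w => dampedField a G (max t 0) (ρ w)
  have hlip (t : ℝ) : LipschitzWith K (f t) := lipschitzOnWith_univ.1 <| by
    simpa only [mul_one] using!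
      (hK _ (le_max_right t 0)).comp hρ.lipschitzOnWith fun w _ => hρ_mem w
  have hbdd (t : ℝ) (w : ℝ × ℝ) : ‖f t w‖ ≤ (K * R.toNNReal + ‖deriv G 0‖₊ : NNReal) := by
    have hdist : ‖f t w - dampedField a G (max t 0) 0‖ ≤ K * ‖ρ w‖ := by
      simpa only [dist_eq_norm, sub_zero] using
        (hK _ (le_max_right t 0)).dist_le_mul _ (hρ_mem w) 0 (mem_closedBall_self hR)
    have hzero : ‖dampedField a G (max t 0) 0‖ = ‖deriv G 0‖ := by simp [dampedField]
    have hρR : K * ‖ρ w‖ ≤ K * R := by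
      gcongr
      exact mem_closedBall_zero_iff.1 (hρ_mem w)
    rw [NNReal.coe_add, NNReal.coe_mul, Real.coe_toNNReal R hR, coe_nnnorm]
    linarith [norm_le_norm_sub_add (f t w) (dampedField a G (max t 0) 0)]
  obtain ⟨γ, hγs, hγ⟩ := exists_isIntegralCurve_of_lipschitzWith_of_bounded hlip
    (fun w => h.continuous_dampedField_max (ρ w)) hbdd s w
  refine ⟨γ, hγs, hγ.continuous, fun t ht hγt => ?_⟩
  simpa only [f, max_eq_left ht, hρ_fix _ (mem_closedBall_zero_iff.2 hγt)] using hγ t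

theorem exists_isTrajectory (h : DampedSystem a G) (hs : 0 ≤ s) (w : ℝ × ℝ) :
    ∃ γ, IsTrajectory a G γ ∧ γ s = w := by
  obtain ⟨e, he⟩ := h.exists_energy_le s (energy G w)
  obtain ⟨R, hR, hnorm⟩ := h.exists_norm_lt_of_energy_le e
  obtain ⟨γ, hγs, hcont, hγ⟩ := h.exists_solution_of_truncation hR.le s w
  have hlt : ∀ t ∈ Ici (0 : ℝ), ‖γ t‖ < R := by
    refine lt_of_forall_uIoo_lt ordConnected_Ici hcont.norm.continuousOn hs fun t ht hbefore => ?_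
    refine hnorm _ (he t γ hs ht hcont.continuousOn (fun r hr => ?_) (by rw [hγs]))
    have hr0 : 0 ≤ r := ordConnected_Ici.uIcc_subset hs ht (uIoo_subset_uIcc_self hr)
    exact (hγ r hr0 (hbefore r hr).le).hasDerivWithinAt
  exact ⟨γ, fun t ht => (hγ t ht (hlt t ht).le).hasDerivWithinAt, hγs⟩

theorem exists_norm_le (h : DampedSystem a G) (hs : 0 ≤ s) (e : ℝ) :
    ∃ R, ∀ γ, IsTrajectory a G γ → energy G (γ s) ≤ e → ∀ t, 0 ≤ t → ‖γ t‖ ≤ R := by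
  obtain ⟨e', he'⟩ := h.exists_energy_le s e
  obtain ⟨R, -, hnorm⟩ := h.exists_norm_lt_of_energy_le e'
  refine ⟨R, fun γ hγ he t ht => (hnorm _ (he' t γ hs ht ?_ ?_ he)).le⟩
  · exact hγ.continuousOn.mono (ordConnected_Ici.uIcc_subset hs ht)
  · exact IsIntegralCurveOn.mono hγ
      (uIoo_subset_uIcc_self.trans (ordConnected_Ici.uIcc_subset hs ht))

theorem exists_dist_le_mul_exp (h : DampedSystem a G) (hs : 0 ≤ s) (e : ℝ) :
    ∃ K : NNReal, ∀ γ η, IsTrajectory a G γ → IsTrajectory a G η → energy G (γ s) ≤ e →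
      energy G (η s) ≤ e → ∀ t, 0 ≤ t →
        dist (γ t) (η t) ≤ dist (γ s) (η s) * Real.exp (K * |t - s|) := by
  obtain ⟨R, hR⟩ := h.exists_norm_le hs e
  obtain ⟨K, hK⟩ := h.exists_lipschitzOnWith_dampedField R
  exact ⟨K, fun γ η hγ hη heγ heη t ht => dist_le_mul_exp_of_isIntegralCurveOn ordConnected_Ici hK
    hγ hη (fun r hr => mem_closedBall_zero_iff.2 (hR γ hγ heγ r hr))
    (fun r hr => mem_closedBall_zero_iff.2 (hR η hη heη r hr)) hs ht⟩

theorem eqOn_of_eq (h : DampedSystem a G) (hγ : IsTrajectory a G γ) (hη : IsTrajectory a G η)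
    (hs : 0 ≤ s) (heq : γ s = η s) : EqOn γ η (Ici 0) := fun t ht => by
  obtain ⟨K, hK⟩ := h.exists_dist_le_mul_exp hs (energy G (γ s))
  have hdist := hK γ η hγ hη le_rfl (by rw [heq]) t ht
  rwa [heq, dist_self, zero_mul, dist_le_zero] at hdist

/-- The trajectory passing through the state `w` at time `s`. -/
noncomputable def trajectory (h : DampedSystem a G) (hs : 0 ≤ s) (w : ℝ × ℝ) : ℝ → ℝ × ℝ :=
  (h.exists_isTrajectory hs w).choose

theorem isTrajectory_trajectory (h : DampedSystem a G) (hs : 0 ≤ s) (w : ℝ × ℝ) :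
    IsTrajectory a G (h.trajectory hs w) :=
  (h.exists_isTrajectory hs w).choose_spec.1

theorem trajectory_self (h : DampedSystem a G) (hs : 0 ≤ s) (w : ℝ × ℝ) :
    h.trajectory hs w s = w :=
  (h.exists_isTrajectory hs w).choose_spec.2

theorem eqOn_trajectory (h : DampedSystem a G) (hγ : IsTrajectory a G γ) (hs : 0 ≤ s) :
    EqOn γ (h.trajectory hs (γ s)) (Ici 0) :=
  h.eqOn_of_eq hγ (h.isTrajectory_trajectory hs _) hs (h.trajectory_self hs _).symm

theorem continuous_trajectory (h : DampedSystem a G) (hs : 0 ≤ s) (ht : 0 ≤ t) :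
    Continuous fun w => h.trajectory hs w t := by
  refine continuous_iff_continuousAt.2 fun w => ?_
  obtain ⟨K, hK⟩ := h.exists_dist_le_mul_exp hs (energy G w + 1)
  have hnear : ∀ᶠ w' in 𝓝 w, energy G w' < energy G w + 1 :=
    h.continuous_energy.continuousAt.eventually_lt_const (lt_add_one _)
  refine tendsto_iff_dist_tendsto_zero.2 <| squeeze_zero' (.of_forall fun _ => dist_nonneg)
    (g := fun w' => dist w' w * Real.exp (K * |t - s|)) ?_ ?_
  · filter_upwards [hnear] with w' hw'
    simpa only [trajectory_self] using hK _ _ (h.isTrajectory_trajectory hs w')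
      (h.isTrajectory_trajectory hs w) (by simpa only [trajectory_self] using hw'.le)
      (by simpa only [trajectory_self] using (lt_add_one _).le) t ht
  · have hcont : Continuous fun w' => dist w' w * Real.exp (K * |t - s|) := by fun_prop
    simpa using hcont.tendsto w

theorem isSolutionFrom (h : DampedSystem a G) (hγ : IsTrajectory a G γ) :
    IsSolutionFrom a G (γ 0) fun t => (γ t).1 := by
  have hU : UniqueDiffOn ℝ (Ici (0 : ℝ)) := uniqueDiffOn_Ici 0
  have hfst : ∀ t ∈ Ici (0 : ℝ), HasDerivWithinAt (fun t => (γ t).1) (γ t).2 (Ici 0) t :=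
    fun t ht => (hγ t ht).fst
  have hsnd : ∀ t ∈ Ici (0 : ℝ), HasDerivWithinAt (fun t => (γ t).2)
      (-(a t * (γ t).2) - deriv G (γ t).1) (Ici 0) t := fun t ht => (hγ t ht).snd
  have hvel : EqOn (derivWithin (fun t => (γ t).1) (Ici 0)) (fun t => (γ t).2) (Ici 0) :=
    fun t ht => (hfst t ht).derivWithin (hU t ht)
  have hacc : EqOn (derivWithin (derivWithin (fun t => (γ t).1) (Ici 0)) (Ici 0))
      (fun t => -(a t * (γ t).2) - deriv G (γ t).1) (Ici 0) := fun t ht => by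
    rw [derivWithin_congr hvel (hvel ht)]
    exact (hsnd t ht).derivWithin (hU t ht)
  refine ⟨?_, fun t ht => ?_, rfl, hvel (mem_Ici.2 le_rfl)⟩
  · rw [← one_add_one_eq_two, contDiffOn_succ_iff_derivWithin hU,
      contDiffOn_one_iff_derivWithin hU]
    refine ⟨fun t ht => (hfst t ht).differentiableWithinAt, by simp,
      fun t ht => ((hsnd t ht).congr hvel (hvel ht)).differentiableWithinAt, ?_⟩
    exact ((h.continuousOn.mul hγ.continuousOn.snd).neg.sub
      (h.continuous_deriv.comp_continuousOn hγ.continuousOn.fst)).congr hacc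
  · rw [hacc (mem_Ici.2 ht), hvel (mem_Ici.2 ht)]
    ring

end DampedSystem

theorem IsSolutionFrom.isTrajectory {p : ℝ × ℝ} {x : ℝ → ℝ} (hx : IsSolutionFrom a G p x) :
    IsTrajectory a G fun t => (x t, derivWithin x (Ici 0) t) := by
  have hU : UniqueDiffOn ℝ (Ici (0 : ℝ)) := uniqueDiffOn_Ici 0
  have hC2 := hx.contDiffOn
  rw [← one_add_one_eq_two, contDiffOn_succ_iff_derivWithin hU] at hC2
  intro t ht
  have hvel := (hC2.2.2.differentiableOn one_ne_zero t ht).hasDerivWithinAt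
  exact (hC2.1 t ht).hasDerivWithinAt.prodMk (hvel.congr_deriv (by linarith [hx.equation t ht]))

namespace DampedSystem

theorem isSolutionFrom_trajectory (h : DampedSystem a G) (p : ℝ × ℝ) :
    IsSolutionFrom a G p fun t => (h.trajectory le_rfl p t).1 := by
  simpa only [trajectory_self] using h.isSolutionFrom (h.isTrajectory_trajectory le_rfl p)

theorem eqOn_fst_trajectory (h : DampedSystem a G) {p : ℝ × ℝ} {x : ℝ → ℝ}
    (hx : IsSolutionFrom a G p x) : EqOn x (fun t => (h.trajectory le_rfl p t).1) (Ici 0) := by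
  intro t ht
  have heq := h.eqOn_trajectory hx.isTrajectory le_rfl ht
  rw [hx.initial_position, hx.initial_velocity] at heq
  exact congrArg Prod.fst heq

theorem mem_dataConvergingToLocalMin_iff (h : DampedSystem a G) {p : ℝ × ℝ} :
    p ∈ dataConvergingToLocalMin a G ↔
      ∃ m, IsLocalMin G m ∧ Tendsto (fun t => (h.trajectory le_rfl p t).1) atTop (𝓝 m) := by
  refine ⟨fun ⟨x, hx, m, hm, hlim⟩ => ⟨m, hm, hlim.congr' ?_⟩,
    fun hlim => ⟨_, h.isSolutionFrom_trajectory p, hlim⟩⟩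
  filter_upwards [eventually_ge_atTop 0] with t ht using h.eqOn_fst_trajectory hx ht

end DampedSystem

end WellPosedness

section PassageTime

variable {f f' : ℝ → ℝ} {t s m M : ℝ}

theorem sub_le_div_of_le_abs_deriv (hts : t ≤ s) (hm : 0 < m)
    (hf : ∀ r ∈ Icc t s, HasDerivAt f (f' r) r) (hf' : ∀ r ∈ Icc t s, m ≤ |f' r|)
    (hM : ∀ r ∈ Icc t s, |f r| ≤ M) : s - t ≤ 2 * M / m := by
  have hM_t := hM t (left_mem_Icc.2 hts)
  rcases hts.eq_or_lt with rfl | hlt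
  · rw [sub_self]
    have := (abs_nonneg _).trans hM_t
    positivity
  obtain ⟨ξ, hξ, hslope⟩ := exists_hasDerivAt_eq_slope f f' hlt
    (fun r hr => (hf r hr).continuousAt.continuousWithinAt)
    fun r hr => hf r (Ioo_subset_Icc_self hr)
  rw [le_div_iff₀ hm]
  calc (s - t) * m ≤ (s - t) * |f' ξ| :=
        mul_le_mul_of_nonneg_left (hf' ξ (Ioo_subset_Icc_self hξ)) (sub_nonneg.2 hts)
    _ = |f s - f t| := by
        rw [hslope, abs_div, abs_of_pos (sub_pos.2 hlt), mul_div_cancel₀ _ (sub_pos.2 hlt).ne']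
    _ ≤ |f s| + |f t| := abs_sub _ _
    _ ≤ 2 * M := by linarith [hM s (right_mem_Icc.2 hts)]

theorem sub_le_arsinh_of_le_sq {y v : ℝ → ℝ} {e δ ρ : ℝ} (hts : t ≤ s) (he : 0 < e)
    (hδ : 0 < δ) (hy : ∀ r ∈ Icc t s, HasDerivAt y (v r) r)
    (hv : ∀ r ∈ Icc t s, e + δ * y r ^ 2 ≤ v r ^ 2 / 2) (hρ : ∀ r ∈ Icc t s, |y r| ≤ ρ) :
    s - t ≤ 2 * Real.arsinh (√(δ / e) * ρ) / √(2 * δ) := by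
  set k := √(δ / e)
  have hk : 0 < k := Real.sqrt_pos.2 (by positivity)
  have hk_sq : k ^ 2 = δ / e := Real.sq_sqrt (by positivity)
  refine sub_le_div_of_le_abs_deriv hts (by positivity)
    (fun r hr => ((hy r hr).const_mul k).arsinh) (fun r hr => ?_) fun r hr => ?_
  · have hroot : 0 < √(1 + (k * y r) ^ 2) := Real.sqrt_pos.2 (by positivity)
    rw [smul_eq_mul, abs_mul, abs_inv, abs_of_pos hroot, inv_mul_eq_div, le_div_iff₀ hroot,
      ← Real.sqrt_mul (by positivity)]
    refine Real.sqrt_le_iff.2 ⟨abs_nonneg _, ?_⟩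
    calc 2 * δ * (1 + (k * y r) ^ 2) = 2 * (δ / e) * (e + δ * y r ^ 2) := by
          rw [mul_pow, hk_sq]
          field_simp
      _ ≤ 2 * (δ / e) * (v r ^ 2 / 2) := by gcongr; exact hv r hr
      _ = |k * v r| ^ 2 := by rw [sq_abs, mul_pow, hk_sq]; ring
  · have habs : |k * y r| ≤ k * ρ := by
      rw [abs_mul, abs_of_pos hk]
      exact mul_le_mul_of_nonneg_left (hρ r hr) hk.le
    rw [abs_le, ← Real.arsinh_neg, Real.arsinh_le_arsinh, Real.arsinh_le_arsinh]
    exact abs_le.1 habs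

theorem arsinh_le_log_one_add {y : ℝ} (hy : 0 ≤ y) : Real.arsinh y ≤ Real.log (1 + 2 * y) := by
  have hroot : √(1 + y ^ 2) ≤ 1 + y := Real.sqrt_le_iff.2 ⟨by positivity, by nlinarith⟩
  exact Real.log_le_log (by positivity) (by linarith)

theorem log_one_add_one_div_nonneg {e : ℝ} (he : 0 ≤ e) : 0 ≤ Real.log (1 + 1 / e) :=
  Real.log_nonneg (by simp [he])

theorem exists_arsinh_sqrt_div_le_log {δ ρ : ℝ} (hδ : 0 < δ) (hρ : 0 ≤ ρ) :
    ∃ C ≥ 0, ∀ e > 0, Real.arsinh (√(δ / e) * ρ) ≤ C * (1 + Real.log (1 + 1 / e)) := by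
  have hlog : 0 ≤ Real.log (1 + ρ * δ + ρ) :=
    Real.log_nonneg (by linarith [mul_nonneg hρ hδ.le])
  refine ⟨1 + Real.log (1 + ρ * δ + ρ), by positivity, fun e he => ?_⟩
  have hlog_inv := log_one_add_one_div_nonneg he.le
  have hamgm : 2 * √(δ / e) ≤ δ + 1 / e := by
    rw [div_eq_mul_one_div, Real.sqrt_mul hδ.le]
    nlinarith [sq_nonneg (√δ - √(1 / e)), Real.sq_sqrt hδ.le, Real.sq_sqrt (one_div_pos.2 he).le]
  calc Real.arsinh (√(δ / e) * ρ) ≤ Real.log (1 + 2 * (√(δ / e) * ρ)) :=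
        arsinh_le_log_one_add (by positivity)
    _ ≤ Real.log ((1 + ρ * δ + ρ) * (1 + 1 / e)) := by
        refine Real.log_le_log (by positivity) ?_
        have hexpand : 0 ≤ ρ * δ * (1 / e) + 1 / e := by positivity
        linarith [mul_le_mul_of_nonneg_right hamgm hρ]
    _ = Real.log (1 + ρ * δ + ρ) + Real.log (1 + 1 / e) :=
        Real.log_mul (by positivity) (by positivity)
    _ ≤ (1 + Real.log (1 + ρ * δ + ρ)) * (1 + Real.log (1 + 1 / e)) := by
        nlinarith [mul_nonneg hlog hlog_inv]

end PassageTime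

section LogarithmicLosses

variable {C κ τ : ℝ}

theorem exists_eventually_sub_le_mul_log (hC : 0 ≤ C) (hκ : 0 < κ) (hτ : 0 ≤ τ) :
    ∃ M ≥ 0, ∀ᶠ t in atTop, ∀ s ≥ t, s - t ≤ C * (1 + Real.log (1 + s / κ)) →
      s ≤ 2 * t ∧ s + τ - t ≤ M * Real.log t := by
  refine ⟨6 * C + τ, by positivity, ?_⟩
  have hquadratic : ∀ᶠ s : ℝ in atTop, 1 + s / κ ≤ s ^ 2 := by
    filter_upwards [eventually_ge_atTop (1 + 1 / κ)] with s hs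
    have hκ' : 0 < 1 / κ := by positivity
    rw [div_eq_mul_one_div]
    nlinarith
  have hsublinear : ∀ᶠ s : ℝ in atTop, 3 * C * Real.log s ≤ s / 2 := by
    filter_upwards [(Real.isLittleO_log_id_atTop.const_mul_left (3 * C)).bound one_half_pos,
      eventually_ge_atTop 0] with s hs hs0
    rw [id, Real.norm_of_nonneg hs0] at hs
    linarith [Real.le_norm_self (3 * C * Real.log s)]
  filter_upwards [eventually_forall_ge_atTop.2 (hquadratic.and hsublinear),
    Real.tendsto_log_atTop.eventually_ge_atTop 1, eventually_ge_atTop 2] with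
    t hlarge hlog ht s hts hs
  have hs0 : 0 < s := by linarith
  have hlog_s : 1 ≤ Real.log s := hlog.trans (Real.log_le_log (by linarith) hts)
  have hlog_quad : Real.log (1 + s / κ) ≤ 2 * Real.log s := by
    rw [← Real.log_rpow hs0, Real.rpow_two]
    exact Real.log_le_log (by positivity) (hlarge s hts).1
  have hgap : s - t ≤ 3 * C * Real.log s := hs.trans (by nlinarith)
  have hs2 : s ≤ 2 * t := by linarith [(hlarge s hts).2]
  have hlog_le : Real.log s ≤ 2 * Real.log t := by
    rw [← Real.log_rpow (by linarith), Real.rpow_two]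
    exact Real.log_le_log hs0 (by nlinarith)
  exact ⟨hs2, by nlinarith⟩

theorem log_log_sub_le {t r M : ℝ} (ht : 1 < t) (htr : t ≤ r) (hM : r - t ≤ M * Real.log t) :
    Real.log (Real.log r) - Real.log (Real.log t) ≤ M / t := by
  have hlog_sub {p q : ℝ} (hp : 0 < p) (hpq : p ≤ q) :
      Real.log q - Real.log p ≤ (q - p) / p := by
    rw [← Real.log_div (hp.trans_le hpq).ne' hp.ne', sub_div, div_self hp.ne']
    exact Real.log_le_sub_one_of_pos (div_pos (hp.trans_le hpq) hp)
  have ht0 : 0 < t := one_pos.trans ht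
  have hlog : 0 < Real.log t := Real.log_pos ht
  calc Real.log (Real.log r) - Real.log (Real.log t)
      ≤ (Real.log r - Real.log t) / Real.log t := hlog_sub hlog (Real.log_le_log ht0 htr)
    _ ≤ (r - t) / t / Real.log t := by gcongr; exact hlog_sub ht0 htr
    _ ≤ M * Real.log t / t / Real.log t := by gcongr
    _ = M / t := by field_simp

theorem not_tendsto_atTop_of_forall_exists_add_le {Q : ℝ → ℝ} {T : ℝ} (hτ : 0 < τ)
    (hQ : ∀ t ≥ T, ∃ r, t + τ ≤ r ∧ Q r ≤ Q t) : ¬ Tendsto Q atTop atTop := by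
  intro hlim
  obtain ⟨B, hB⟩ := eventually_atTop.1 (hlim.eventually_gt_atTop (Q T))
  set S := {t | T ≤ t ∧ Q t ≤ Q T}
  have hS : BddAbove S := ⟨B, fun t ht => le_of_not_ge fun hBt => (hB t hBt).not_ge ht.2⟩
  obtain ⟨t, ht, hlt⟩ := exists_lt_of_lt_csSup (⟨T, le_rfl, le_rfl⟩ : S.Nonempty)
    (sub_lt_self (sSup S) hτ)
  obtain ⟨r, htr, hr⟩ := hQ t ht.1
  have hrS : r ∈ S := ⟨by linarith [ht.1], hr.trans ht.2⟩
  linarith [le_csSup hS hrS]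

/-- Quantitatively this is the divergence of `∑ 1 / (n log n)`: the times `s` may be about `log s`
apart, and each costs `κ / s`. -/
theorem not_eventually_exists_logarithmic_loss {e : ℝ → ℝ} (he0 : ∀ t, 0 ≤ t → 0 ≤ e t)
    (he : AntitoneOn e (Ici 0)) (hC : 0 ≤ C) (hκ : 0 < κ) (hτ : 0 < τ) :
    ¬ ∀ᶠ t in atTop, ∃ s ≥ t, s - t ≤ C * (1 + Real.log (1 + 1 / e s)) ∧
      e (s + τ) + κ / s ≤ e s := by
  intro hloss
  obtain ⟨M, hM, hgap⟩ := exists_eventually_sub_le_mul_log hC hκ hτ.le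
  obtain ⟨T, hT⟩ := eventually_atTop.1
    ((hloss.and hgap).and (eventually_gt_atTop 1))
  refine not_tendsto_atTop_of_forall_exists_add_le
    (Q := fun t => Real.log (Real.log t) + 2 * M / κ * e t) (T := T) hτ (fun t ht => ?_)
    (tendsto_atTop_add_right_of_le' _ 0 (Real.tendsto_log_atTop.comp Real.tendsto_log_atTop)
      ((eventually_ge_atTop 0).mono fun t ht => mul_nonneg (by positivity) (he0 t ht)))
  obtain ⟨⟨⟨s, hts, hs, hdrop⟩, hgap⟩, ht1⟩ := hT t ht
  have hs0 : 0 < s := by linarith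
  have hκs : 0 < κ / s := by positivity
  have hes : κ / s ≤ e s := by linarith [he0 (s + τ) (by linarith)]
  have hinv : 1 / e s ≤ s / κ := by
    simpa only [one_div_div] using one_div_le_one_div_of_le hκs hes
  have hes0 : 0 < 1 / e s := one_div_pos.2 (hκs.trans_le hes)
  obtain ⟨hs2, hsτ⟩ := hgap s hts (hs.trans (by gcongr))
  have hanti : e s ≤ e t := he (mem_Ici.2 (by linarith)) hs0.le hts
  refine ⟨s + τ, by linarith, ?_⟩
  have hgain : M / t ≤ 2 * M / κ * (κ / s) := by
    rw [div_mul_div_cancel₀ hκ.ne', div_le_div_iff₀ (by linarith) hs0]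
    nlinarith
  have hloglog := log_log_sub_le ht1 (by linarith) hsτ
  have := mul_le_mul_of_nonneg_left (hdrop.trans hanti) (by positivity : 0 ≤ 2 * M / κ)
  linarith

end LogarithmicLosses

section IsolatedLevels

open Metric

theorem lt_of_isPreconnected_of_forall_ne {X : Type*} [TopologicalSpace X] {S : Set X} {g : X → ℝ}
    {ρ : ℝ} {x : X} (hS : IsPreconnected S) (hg : ContinuousOn g S) (hne : ∀ y ∈ S, g y ≠ ρ)
    (hx : x ∈ S) (hlt : g x < ρ) : ∀ y ∈ S, g y < ρ := by
  intro y hy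
  by_contra! hle
  obtain ⟨z, hz, hzρ⟩ := hS.intermediate_value hx hy hg ⟨hlt.le, hle⟩
  exact hne z hz hzρ

theorem exists_isPreconnected_subset_of_abs_sub_lt {X : Type*} [PseudoMetricSpace X] {K : Set X}
    (hK : IsCompact K) {f : X → ℝ} (hf : Continuous f) {e : ℝ}
    (hiso : ∀ y ∈ K, f y = e → ∀ᶠ z in 𝓝[≠] y, f z ≠ e) {U : X → Set X}
    (hU : ∀ y ∈ K, f y = e → U y ∈ 𝓝 y) :
    ∃ A : Finset X, (∀ y ∈ A, f y = e) ∧ ∃ μ > 0, ∀ S ⊆ K, IsPreconnected S →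
      S.Nonempty → (∀ z ∈ S, |f z - e| < μ) → ∃ y ∈ A, S ⊆ U y := by
  have hball : ∀ y ∈ K ∩ f ⁻¹' {e}, ∃ ρ > 0,
      closedBall y ρ ⊆ {z | (z ≠ y → f z ≠ e) ∧ z ∈ U y} := fun y hy =>
    nhds_basis_closedBall.mem_iff.1
      ((eventually_nhdsWithin_iff.1 (hiso y hy.1 hy.2)).and (hU y hy.1 hy.2))
  choose! ρ hρ hρU using hball
  obtain ⟨A, hA, hcover⟩ := (hK.inter_right (isClosed_singleton.preimage hf)).elim_nhds_subcover
    (fun y => ball y (ρ y)) fun y hy => ball_mem_nhds y (hρ y hy)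
  have hbarrier : IsCompact (K \ (⋃ y ∈ A, ball y (ρ y)) ∪ ⋃ y ∈ A, K ∩ sphere y (ρ y)) :=
    (hK.diff (isOpen_biUnion fun y _ => isOpen_ball)).union
      (A.isCompact_biUnion fun y _ => hK.inter_right isClosed_sphere)
  have hbarrier_ne : ∀ z ∈ K \ (⋃ y ∈ A, ball y (ρ y)) ∪ ⋃ y ∈ A, K ∩ sphere y (ρ y),
      0 < |f z - e| := by
    intro z hz
    rw [abs_pos, sub_ne_zero]
    rcases hz with ⟨hzK, hz⟩ | hz
    · exact fun hze => hz (hcover ⟨hzK, hze⟩)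
    · obtain ⟨y, hy, -, hzy⟩ := mem_iUnion₂.1 hz
      refine (hρU y (hA y hy) (sphere_subset_closedBall hzy)).1 ?_
      rintro rfl
      exact (hρ z (hA z hy)).ne (by simpa using hzy)
  obtain ⟨μ, hμ, hbound⟩ := hbarrier.exists_forall_le' (by fun_prop) hbarrier_ne
  refine ⟨A, fun y hy => (hA y hy).2, μ, hμ, fun S hSK hS hne hSμ => ?_⟩
  have hS_barrier : ∀ z ∈ S, z ∉ K \ (⋃ y ∈ A, ball y (ρ y)) ∪ ⋃ y ∈ A, K ∩ sphere y (ρ y) :=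
    fun z hz hmem => (hSμ z hz).not_ge (hbound z hmem)
  obtain ⟨x, hx⟩ := hne
  obtain ⟨y, hy, hxy⟩ := mem_iUnion₂.1 <|
    not_not.1 fun hmem => hS_barrier x hx (.inl ⟨hSK hx, hmem⟩)
  have hin_ball := lt_of_isPreconnected_of_forall_ne hS (g := (dist · y)) (by fun_prop)
    (fun z hz heq => hS_barrier z hz (.inr (mem_iUnion₂.2 ⟨y, hy, hSK hz, heq⟩))) hx hxy
  exact ⟨y, hy, fun z hz => (hρU y (hA y hy) (mem_closedBall.2 (hin_ball z hz).le)).2⟩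

theorem exists_tendsto_of_tendsto_comp {X : Type*} [PseudoMetricSpace X] {K : Set X}
    (hK : IsCompact K) {f : X → ℝ} (hf : Continuous f) {e : ℝ}
    (hiso : ∀ y ∈ K, f y = e → ∀ᶠ z in 𝓝[≠] y, f z ≠ e) {x : ℝ → X} {T : ℝ}
    (hx : ContinuousOn x (Ici T)) (hxK : MapsTo x (Ici T) K)
    (hlim : Tendsto (fun t => f (x t)) atTop (𝓝 e)) : ∃ c, Tendsto x atTop (𝓝 c) := by
  have hcauchy : Cauchy (map x atTop) := by
    refine Metric.cauchy_iff.2 ⟨inferInstance, fun ε hε => ?_⟩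
    obtain ⟨A, -, μ, hμ, hA⟩ := exists_isPreconnected_subset_of_abs_sub_lt hK hf hiso
      (U := fun y => ball y (ε / 2)) fun y _ _ => ball_mem_nhds y (half_pos hε)
    obtain ⟨T', hT'⟩ := eventually_atTop.1
      ((hlim.eventually (ball_mem_nhds e hμ)).and (eventually_ge_atTop T))
    have hsub : Ici T' ⊆ Ici T := Ici_subset_Ici.2 (hT' T' le_rfl).2
    obtain ⟨y, -, hy⟩ := hA (x '' Ici T') (image_subset_iff.2 fun t ht => hxK (hsub ht))
      (isPreconnected_Ici.image x (hx.mono hsub)) (nonempty_Ici.image x)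
      (forall_mem_image.2 fun t ht => (hT' t ht).1)
    refine ⟨x '' Ici T', image_mem_map (Ici_mem_atTop T'), fun p hp q hq => ?_⟩
    linarith [dist_triangle_right p q y, mem_ball.1 (hy hp), mem_ball.1 (hy hq)]
  obtain ⟨c, -, hc⟩ := hK.isComplete (map x atTop) hcauchy
    (tendsto_principal.2 ((eventually_ge_atTop T).mono hxK))
  exact ⟨c, hc⟩

end IsolatedLevels

section ScalarLimits

theorem eq_zero_of_tendsto_of_tendsto_deriv {f f' : ℝ → ℝ} {l d : ℝ}
    (hf : ∀ᶠ t in atTop, HasDerivAt f (f' t) t) (hlim : Tendsto f atTop (𝓝 l))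
    (hlim' : Tendsto f' atTop (𝓝 d)) : d = 0 := by
  obtain ⟨T, hT⟩ := eventually_atTop.1 hf
  have hslope : ∀ t ≥ T, ∃ ξ ∈ Ioo t (t + 1), f' ξ = f (t + 1) - f t := fun t ht => by
    simpa only [add_sub_cancel_left, div_one] using
      exists_hasDerivAt_eq_slope f f' (lt_add_one t)
        (fun r hr => (hT r (ht.trans hr.1)).continuousAt.continuousWithinAt)
        fun r hr => hT r (ht.trans hr.1.le)
  choose! ξ hξ hξ_slope using hslope
  have hξ_top : Tendsto ξ atTop atTop :=
    tendsto_atTop_mono' atTop ((eventually_ge_atTop T).mono fun t ht => (hξ t ht).1.le) tendsto_id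
  have hincrement : Tendsto (fun t => f (t + 1) - f t) atTop (𝓝 (l - l)) :=
    (hlim.comp (tendsto_atTop_add_const_right _ 1 tendsto_id)).sub hlim
  rw [sub_self] at hincrement
  exact tendsto_nhds_unique ((hlim'.comp hξ_top).congr' <|
    (eventually_ge_atTop T).mono hξ_slope) hincrement

theorem exists_ge_le_and_eq_or_forall_le {g : ℝ → ℝ} {t v : ℝ} (hg : ContinuousOn g (Ici t))
    (hv : ∃ s ≥ t, v ≤ g s) : ∃ s ≥ t, v ≤ g s ∧ (s = t ∨ ∀ r ∈ Icc t s, g r ≤ v) := by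
  have hclosed : IsClosed (Ici t ∩ g ⁻¹' Ici v) :=
    hg.preimage_isClosed_of_isClosed isClosed_Ici isClosed_Ici
  have hleast := hclosed.isLeast_csInf (nonempty_def.2 hv) ⟨t, fun s hs => hs.1⟩
  set s := sInf (Ici t ∩ g ⁻¹' Ici v)
  have hts : t ≤ s := hleast.1.1
  refine ⟨s, hts, hleast.1.2, or_iff_not_imp_left.2 fun hne => ?_⟩
  rw [← closure_Ico (Ne.symm hne)]
  refine fun r hr => le_on_closure (fun r hr => ?_) (hg.mono ?_) continuousOn_const hr
  · exact (not_le.1 fun hvr => hr.2.not_ge (hleast.2 ⟨hr.1, hvr⟩)).le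
  · rw [closure_Ico (Ne.symm hne)]
    exact Icc_subset_Ici_self

end ScalarLimits

section Nondegenerate

variable {G : ℝ → ℝ} {c : ℝ}

namespace StronglyConvexNear

theorem eventually_nhds (hG : StronglyConvexNear G c) : ∀ᶠ y in 𝓝 c, StronglyConvexNear G y := by
  obtain ⟨ε, hε, δ, hδ, hconv⟩ := hG
  filter_upwards [Metric.ball_mem_nhds c (half_pos hε)] with y hy
  rw [Real.ball_eq_Ioo] at hy
  have hsub : Ioo (y - ε / 2) (y + ε / 2) ⊆ Ioo (c - ε) (c + ε) :=
    Ioo_subset_Ioo (by linarith [hy.1]) (by linarith [hy.2])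
  exact ⟨ε / 2, half_pos hε, δ, hδ, fun x hx z hz => hconv x (hsub hx) z (hsub hz)⟩

theorem exists_eventually_le (hG : StronglyConvexNear G c) (hc : deriv G c = 0) :
    ∃ δ > 0, ∀ᶠ y in 𝓝 c, G c + δ * (y - c) ^ 2 ≤ G y := by
  obtain ⟨ε, hε, δ, hδ, hconv⟩ := hG
  refine ⟨δ, hδ, ?_⟩
  filter_upwards [Metric.ball_mem_nhds c hε] with y hy
  rw [Real.ball_eq_Ioo] at hy
  simpa only [hc, mul_zero, add_zero] using hconv c ⟨by linarith, by linarith⟩ y hy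

theorem exists_eventually_le_mul_sub (hG : StronglyConvexNear G c) :
    ∃ δ > 0, ∀ᶠ p in 𝓝 c ×ˢ 𝓝 c,
      2 * δ * (p.2 - p.1) ^ 2 ≤ (deriv G p.2 - deriv G p.1) * (p.2 - p.1) := by
  obtain ⟨ε, hε, δ, hδ, hconv⟩ := hG
  refine ⟨δ, hδ, ?_⟩
  have hball := Metric.ball_mem_nhds c hε
  filter_upwards [prod_mem_prod hball hball] with p hp
  rw [Real.ball_eq_Ioo] at hp
  linarith [hconv p.1 hp.1 p.2 hp.2, hconv p.2 hp.2 p.1 hp.1]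

theorem isLocalMin (hG : StronglyConvexNear G c) (hc : deriv G c = 0) : IsLocalMin G c := by
  obtain ⟨δ, hδ, hle⟩ := hG.exists_eventually_le hc
  filter_upwards [hle] with y hy
  linarith [mul_nonneg hδ.le (sq_nonneg (y - c))]

theorem eventually_lt (hG : StronglyConvexNear G c) (hc : deriv G c = 0) :
    ∀ᶠ y in 𝓝[≠] c, G c < G y := by
  obtain ⟨δ, hδ, hle⟩ := hG.exists_eventually_le hc
  filter_upwards [nhdsWithin_le_nhds hle, self_mem_nhdsWithin] with y hy hne
  linarith [mul_pos hδ (sq_pos_of_ne_zero (sub_ne_zero.2 hne))]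

end StronglyConvexNear

namespace StronglyConcaveNear

theorem exists_eventually_le (hG : StronglyConcaveNear G c) (hc : deriv G c = 0) :
    ∃ δ > 0, ∀ᶠ y in 𝓝 c, G y ≤ G c - δ * (y - c) ^ 2 := by
  obtain ⟨δ, hδ, hle⟩ := StronglyConvexNear.exists_eventually_le hG (by simp [hc])
  exact ⟨δ, hδ, hle.mono fun y hy => by linarith⟩

theorem eventually_lt (hG : StronglyConcaveNear G c) (hc : deriv G c = 0) :
    ∀ᶠ y in 𝓝[≠] c, G y < G c :=
  (StronglyConvexNear.eventually_lt hG (by simp [hc])).mono fun _ hy => neg_lt_neg_iff.1 hy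

theorem not_isLocalMin (hG : StronglyConcaveNear G c) (hc : deriv G c = 0) :
    ¬ IsLocalMin G c := fun hmin =>
  let ⟨_, hlt, hle⟩ := ((hG.eventually_lt hc).and (nhdsWithin_le_nhds hmin)).exists
  hlt.not_ge hle

theorem exists_eventually_mul_sub_le (hG : StronglyConcaveNear G c) :
    ∃ δ > 0, ∀ᶠ p in 𝓝 c ×ˢ 𝓝 c,
      (deriv G p.2 - deriv G p.1) * (p.2 - p.1) ≤ -(2 * δ * (p.2 - p.1) ^ 2) := by
  obtain ⟨δ, hδ, hle⟩ := StronglyConvexNear.exists_eventually_le_mul_sub hG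
  refine ⟨δ, hδ, hle.mono fun p hp => ?_⟩
  rw [deriv.fun_neg, deriv.fun_neg] at hp
  linarith

end StronglyConcaveNear

end Nondegenerate

section Dissipation

variable {a G : ℝ → ℝ} {γ : ℝ → ℝ × ℝ} {c s : ℝ}

theorem exists_tendsto_of_antitoneOn_Ici {f : ℝ → ℝ} {m : ℝ} (hf : AntitoneOn f (Ici s))
    (hm : ∀ t, s ≤ t → m ≤ f t) : ∃ l, Tendsto f atTop (𝓝 l) ∧ ∀ t, s ≤ t → l ≤ f t := by
  have hanti : Antitone fun t => f (max s t) := fun t r htr =>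
    hf (le_max_left s t) (le_max_left s r) (max_le_max_left s htr)
  have hbdd : BddBelow (range fun t => f (max s t)) :=
    ⟨m, forall_mem_range.2 fun t => hm _ (le_max_left s t)⟩
  refine ⟨⨅ t, f (max s t), (tendsto_atTop_ciInf hanti hbdd).congr' ?_, fun t ht => ?_⟩
  · filter_upwards [eventually_ge_atTop s] with t ht
    rw [max_eq_right ht]
  · simpa only [max_eq_right ht] using ciInf_le hbdd t

/-- A damped system whose damping vanishes at infinity, though no faster than `1 / t`, and whose
potential has only nondegenerate critical points. -/
structure SlowlyDampedSystem (a G : ℝ → ℝ) : Prop extends DampedSystem a G where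
  tendsto_zero : Tendsto a atTop (𝓝 0)
  exists_le : ∃ c > 0, ∀ t, 0 ≤ t → c / (t + 1) ≤ a t
  nondegenerate : ∀ c, deriv G c = 0 → StronglyConvexNear G c ∨ StronglyConcaveNear G c

namespace IsTrajectory

theorem antitoneOn_energy (hγ : IsTrajectory a G γ) (h : DampedSystem a G) :
    AntitoneOn (fun t => energy G (γ t)) (Ici 0) :=
  h.antitoneOn_energy (convex_Ici 0) le_rfl hγ.continuousOn (hγ.mono interior_subset)

theorem exists_tendsto_energy (hγ : IsTrajectory a G γ) (h : DampedSystem a G) :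
    ∃ e, Tendsto (fun t => energy G (γ t)) atTop (𝓝 e) ∧ ∀ t, 0 ≤ t → e ≤ energy G (γ t) :=
  let ⟨_, hm⟩ := h.exists_forall_le
  exists_tendsto_of_antitoneOn_Ici (hγ.antitoneOn_energy h) fun _ _ =>
    (hm _).trans (le_energy G _)

theorem exists_norm_le (hγ : IsTrajectory a G γ) (h : DampedSystem a G) :
    ∃ R, ∀ t, 0 ≤ t → ‖γ t‖ ≤ R :=
  let ⟨R, hR⟩ := h.exists_norm_le le_rfl (energy G (γ 0))
  ⟨R, hR γ hγ le_rfl⟩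

theorem exists_norm_field_le (hγ : IsTrajectory a G γ) (h : DampedSystem a G) :
    ∃ B > 0, ∀ t, 0 ≤ t → |-(a t * (γ t).2) - deriv G (γ t).1| ≤ B := by
  obtain ⟨R, hR⟩ := hγ.exists_norm_le h
  obtain ⟨A, hA⟩ := h.bounded
  obtain ⟨B, hB⟩ := (isCompact_closedBall (0 : ℝ) R).exists_bound_of_continuousOn
    h.continuous_deriv.continuousOn
  refine ⟨max (A * R + B) 1, by positivity, fun t ht => le_max_of_le_left ?_⟩
  have hforce := hB (γ t).1 (mem_closedBall_zero_iff.2 ((norm_fst_le _).trans (hR t ht)))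
  have hfriction : |a t * (γ t).2| ≤ A * R := by
    rw [abs_mul, abs_of_nonneg (h.nonneg t ht)]
    exact mul_le_mul (hA t ht) ((norm_snd_le _).trans (hR t ht)) (abs_nonneg _)
      ((h.nonneg t ht).trans (hA t ht))
  calc |-(a t * (γ t).2) - deriv G (γ t).1| ≤ |-(a t * (γ t).2)| + |deriv G (γ t).1| := abs_sub _ _
    _ ≤ A * R + B := by rw [abs_neg]; exact add_le_add hfriction hforce

theorem exists_forall_half_le_abs_snd (hγ : IsTrajectory a G γ) (h : DampedSystem a G) {v : ℝ}
    (hv : 0 < v) :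
    ∃ τ > 0, ∀ s, 0 < s → v ≤ |(γ s).2| → ∀ r ∈ Icc s (s + τ), v / 2 ≤ |(γ r).2| := by
  obtain ⟨B, hB, hfield⟩ := hγ.exists_norm_field_le h
  refine ⟨v / (2 * B), by positivity, fun s hs hvs r hr => ?_⟩
  have hdist : |(γ r).2 - (γ s).2| ≤ B * |r - s| :=
    (convex_Icc s r).norm_image_sub_le_of_norm_hasDerivWithin_le
      (fun t ht => (hγ.hasDerivAt_snd (hs.trans_le ht.1)).hasDerivWithinAt)
      (fun t ht => hfield t (hs.le.trans ht.1)) (left_mem_Icc.2 hr.1) (right_mem_Icc.2 hr.1)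
  have htime : B * |r - s| ≤ v / 2 := by
    rw [abs_of_nonneg (sub_nonneg.2 hr.1)]
    calc B * (r - s) ≤ B * (v / (2 * B)) := by gcongr; linarith [hr.2]
      _ = v / 2 := by field_simp
  linarith [abs_sub_abs_le_abs_sub (γ s).2 (γ r).2, abs_sub_comm (γ s).2 (γ r).2]

theorem exists_energy_add_le (hγ : IsTrajectory a G γ) (h : SlowlyDampedSystem a G) {v : ℝ}
    (hv : 0 < v) :
    ∃ τ > 0, ∃ κ > 0, ∀ s, 1 ≤ s → v ≤ |(γ s).2| →
      energy G (γ (s + τ)) + κ / s ≤ energy G (γ s) := by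
  obtain ⟨τ, hτ, hfast⟩ := hγ.exists_forall_half_le_abs_snd h.toDampedSystem hv
  obtain ⟨c, hc, hac⟩ := h.exists_le
  refine ⟨τ, hτ, c * (v / 2) ^ 2 * τ / (2 + τ), by positivity, fun s hs hvs => ?_⟩
  have hs0 : 0 < s := one_pos.trans_le hs
  have hrate : ∀ r ∈ interior (Icc s (s + τ)),
      -(a r * (γ r).2 ^ 2) ≤ -(c * (v / 2) ^ 2 / ((2 + τ) * s)) := by
    intro r hr
    rw [interior_Icc] at hr
    have hr0 : 0 ≤ r := hs0.le.trans hr.1.le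
    have hdamping : c / ((2 + τ) * s) ≤ a r :=
      (div_le_div_of_nonneg_left hc.le (by linarith) (by nlinarith [hr.2])).trans (hac r hr0)
    have hspeed : (v / 2) ^ 2 ≤ (γ r).2 ^ 2 := by
      rw [← sq_abs (γ r).2]
      exact pow_le_pow_left₀ (by positivity) (hfast s hs0 hvs r (Ioo_subset_Icc_self hr)) 2
    rw [neg_le_neg_iff, mul_div_right_comm]
    exact mul_le_mul hdamping hspeed (by positivity) (h.nonneg r hr0)
  have henergy : ∀ r ∈ Icc s (s + τ),
      HasDerivAt (fun t => energy G (γ t)) (-(a r * (γ r).2 ^ 2)) r := fun r hr =>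
    hasDerivWithinAt_univ.1 <| hasDerivWithinAt_energy (h.differentiable _) <|
      ((hγ r (hs0.le.trans hr.1)).hasDerivAt
        (Ici_mem_nhds (hs0.trans_le hr.1))).hasDerivWithinAt
  have hdrop := (convex_Icc s (s + τ)).image_sub_le_mul_sub_of_deriv_le
    (fun r hr => (henergy r hr).continuousAt.continuousWithinAt)
    (fun r hr => (henergy r (interior_subset hr)).differentiableAt.differentiableWithinAt)
    (fun r hr => (henergy r (interior_subset hr)).deriv.trans_le (hrate r hr))
    s (left_mem_Icc.2 (by linarith)) (s + τ) (right_mem_Icc.2 (by linarith)) (by linarith)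
  have hκ : c * (v / 2) ^ 2 / ((2 + τ) * s) * τ = c * (v / 2) ^ 2 * τ / (2 + τ) / s := by
    field_simp
  linarith

theorem dist_fst_lt_of_energy_lt (hγ : IsTrajectory a G γ) (h : DampedSystem a G) {ρ B T : ℝ}
    (hsphere : ∀ y ∈ Metric.sphere c ρ, B ≤ G y) (hT : 0 ≤ T) (hx : dist (γ T).1 c < ρ)
    (hE : energy G (γ T) < B) : ∀ t, T ≤ t → dist (γ t).1 c < ρ := by
  have hsub : Ici T ⊆ Ici 0 := Ici_subset_Ici.2 hT
  have hfst : ContinuousOn (fun t => (γ t).1) (Ici T) := (hγ.continuousOn.mono hsub).fst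
  refine lt_of_isPreconnected_of_forall_ne isPreconnected_Ici
    (g := fun t => dist (γ t).1 c) (by fun_prop) (fun t ht hρ => ?_)
    self_mem_Ici hx
  exact ((hsphere _ hρ).trans (le_energy G _)).not_gt
    ((hγ.antitoneOn_energy h (hsub self_mem_Ici) (hsub ht) ht).trans_lt hE)

end IsTrajectory

namespace SlowlyDampedSystem

theorem eventually_ne (h : SlowlyDampedSystem a G) (y : ℝ) : ∀ᶠ z in 𝓝[≠] y, G z ≠ G y := by
  by_cases hy : deriv G y = 0
  · rcases h.nondegenerate y hy with hconv | hconc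
    · exact (hconv.eventually_lt hy).mono fun _ => ne_of_gt
    · exact (hconc.eventually_lt hy).mono fun _ => ne_of_lt
  · exact (h.differentiable y).hasDerivAt.eventually_ne hy

end SlowlyDampedSystem

end Dissipation

section Asymptotics

variable {a G : ℝ → ℝ} {γ : ℝ → ℝ × ℝ} {e : ℝ} {U : Set ℝ} {c : ℝ}

/-- Every late stay of the position in `U` which ends at time `s` lasts at most
`C (1 + log (1 + 1 / (E s - e)))`, where `E s` is the energy at that time. -/
def LogarithmicSojourn (G : ℝ → ℝ) (γ : ℝ → ℝ × ℝ) (e : ℝ) (U : Set ℝ) : Prop :=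
  ∃ C ≥ 0, ∀ᶠ t in atTop, ∀ s ≥ t, (∀ r ∈ Icc t s, (γ r).1 ∈ U) → e < energy G (γ s) →
    s - t ≤ C * (1 + Real.log (1 + 1 / (energy G (γ s) - e)))

theorem LogarithmicSojourn.of_eventually_sub_le {B : ℝ}
    (hB : ∀ᶠ t in atTop, ∀ s ≥ t, (∀ r ∈ Icc t s, (γ r).1 ∈ U) → s - t ≤ B) :
    LogarithmicSojourn G γ e U := by
  refine ⟨|B|, abs_nonneg B, hB.mono fun t ht s hts hU hes => ?_⟩
  have hlog := log_one_add_one_div_nonneg (sub_nonneg.2 hes.le)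
  exact (ht s hts hU).trans ((le_abs_self B).trans
    (le_mul_of_one_le_right (abs_nonneg B) (by linarith)))

namespace IsTrajectory

theorem tendsto_friction (hγ : IsTrajectory a G γ) (h : SlowlyDampedSystem a G) :
    Tendsto (fun t => a t * (γ t).2) atTop (𝓝 0) := by
  obtain ⟨R, hR⟩ := hγ.exists_norm_le h.toDampedSystem
  refine h.tendsto_zero.zero_mul_isBoundedUnder_le (isBoundedUnder_of_eventually_le (a := R) ?_)
  filter_upwards [eventually_ge_atTop 0] with t ht using (norm_snd_le _).trans (hR t ht)

theorem exists_logarithmicSojourn_of_deriv_ne_zero (hγ : IsTrajectory a G γ)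
    (h : SlowlyDampedSystem a G) (hc : deriv G c ≠ 0) :
    ∃ U ∈ 𝓝 c, LogarithmicSojourn G γ e U := by
  obtain ⟨R, hR⟩ := hγ.exists_norm_le h.toDampedSystem
  set m := |deriv G c| / 4
  have hm : 0 < m := by positivity
  have hforce : ∀ᶠ y in 𝓝 c, 2 * m < |deriv G y| :=
    h.continuous_deriv.abs.continuousAt.eventually_const_lt
      (by linarith [show |deriv G c| = 4 * m by simp only [m]; ring])
  have hfriction : ∀ᶠ t in atTop, |a t * (γ t).2| ≤ m := by
    simpa using (hγ.tendsto_friction h).norm.eventually_le_const (by simpa using hm)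
  refine ⟨_, hforce, .of_eventually_sub_le (B := 2 * R / m) ?_⟩
  filter_upwards [eventually_forall_ge_atTop.2 hfriction, eventually_gt_atTop 0] with
    t hslow ht s hts hU
  refine sub_le_div_of_le_abs_deriv hts hm (fun r hr => hγ.hasDerivAt_snd (ht.trans_le hr.1))
    (fun r hr => ?_) fun r hr => (norm_snd_le _).trans (hR r (ht.le.trans hr.1))
  have hG : 2 * m < |deriv G (γ r).1| := hU r hr
  have hsum := abs_add_le (a r * (γ r).2) (-(a r * (γ r).2) - deriv G (γ r).1)
  rw [add_sub, add_neg_cancel, zero_sub, abs_neg] at hsum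
  linarith [hslow r hr.1]

theorem exists_logarithmicSojourn_of_stronglyConcaveNear (hγ : IsTrajectory a G γ)
    (h : DampedSystem a G) (hG : StronglyConcaveNear G c) (hc : deriv G c = 0) :
    ∃ U ∈ 𝓝 c, LogarithmicSojourn G γ (G c) U := by
  obtain ⟨δ, hδ, hle⟩ := hG.exists_eventually_le hc
  obtain ⟨C, hC, hlog⟩ := exists_arsinh_sqrt_div_le_log hδ zero_le_one
  refine ⟨_, inter_mem hle (Metric.closedBall_mem_nhds c one_pos),
    2 * C / √(2 * δ), by positivity, ?_⟩
  filter_upwards [eventually_gt_atTop 0] with t ht s hts hU hes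
  refine (sub_le_arsinh_of_le_sq hts (sub_pos.2 hes) hδ
    (fun r hr => (hγ.hasDerivAt_fst (ht.trans_le hr.1)).sub_const c) (fun r hr => ?_)
    fun r hr => (hU r hr).2).trans ?_
  · have hconc : G (γ r).1 ≤ G c - δ * ((γ r).1 - c) ^ 2 := (hU r hr).1
    have henergy : energy G (γ s) ≤ (γ r).2 ^ 2 / 2 + G (γ r).1 :=
      hγ.antitoneOn_energy h (ht.le.trans hr.1) (ht.le.trans hts) hr.2
    linarith
  · rw [mul_div_right_comm, mul_div_right_comm, mul_assoc]
    gcongr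
    exact hlog _ (sub_pos.2 hes)

theorem exists_nhds_tendsto_snd_of_stronglyConvexNear (hγ : IsTrajectory a G γ)
    (h : DampedSystem a G) (hlim : Tendsto (fun t => energy G (γ t)) atTop (𝓝 (G c)))
    (hG : StronglyConvexNear G c) (hc : deriv G c = 0) :
    ∃ U ∈ 𝓝 c, (∃ᶠ t in atTop, (γ t).1 ∈ U) → Tendsto (fun t => (γ t).2) atTop (𝓝 0) := by
  obtain ⟨δ, hδ, hle⟩ := hG.exists_eventually_le hc
  obtain ⟨ρ, hρ, hball⟩ := Metric.nhds_basis_closedBall.mem_iff.1 hle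
  refine ⟨Metric.ball c ρ, Metric.ball_mem_nhds c hρ, fun hfreq => ?_⟩
  obtain ⟨T, hx, hE, hT⟩ := (hfreq.and_eventually ((hlim.eventually_lt_const
    (lt_add_of_pos_right (G c) (by positivity : 0 < δ * ρ ^ 2))).and
    (eventually_ge_atTop 0))).exists
  have hsphere : ∀ y ∈ Metric.sphere c ρ, G c + δ * ρ ^ 2 ≤ G y := fun y hy => by
    rw [← mem_sphere_iff_norm.1 hy, Real.norm_eq_abs, sq_abs]
    exact hball (Metric.sphere_subset_closedBall hy)
  have htrap := hγ.dist_fst_lt_of_energy_lt h hsphere hT hx hE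
  have hsq : Tendsto (fun t => (γ t).2 ^ 2) atTop (𝓝 0) := by
    refine squeeze_zero' (g := fun t => 2 * (energy G (γ t) - G c))
      (Eventually.of_forall fun t => sq_nonneg _) ?_
      (by simpa using (hlim.sub_const (G c)).const_mul 2)
    filter_upwards [eventually_ge_atTop T] with t ht
    have hquad : G c + δ * ((γ t).1 - c) ^ 2 ≤ G (γ t).1 := hball (htrap t ht).le
    have hpos : 0 ≤ δ * ((γ t).1 - c) ^ 2 := by positivity
    unfold energy
    linarith
  refine (tendsto_zero_iff_abs_tendsto_zero _).2 ?_
  simpa [Function.comp_def, Real.sqrt_sq_eq_abs] using hsq.sqrt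

theorem exists_logarithmicSojourn_of_not_tendsto (hγ : IsTrajectory a G γ)
    (h : SlowlyDampedSystem a G) (hlim : Tendsto (fun t => energy G (γ t)) atTop (𝓝 (G c)))
    (hv : ¬ Tendsto (fun t => (γ t).2) atTop (𝓝 0)) :
    ∃ U ∈ 𝓝 c, LogarithmicSojourn G γ (G c) U := by
  by_cases hc : deriv G c = 0
  · rcases h.nondegenerate c hc with hconv | hconc
    · obtain ⟨U, hU, hfreq⟩ :=
        hγ.exists_nhds_tendsto_snd_of_stronglyConvexNear h.toDampedSystem hlim hconv hc
      refine ⟨U, hU, .of_eventually_sub_le (B := 0) ?_⟩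
      filter_upwards [not_frequently.1 fun hf => hv (hfreq hf)] with t ht s hts hstay
      exact absurd (hstay t (left_mem_Icc.2 hts)) ht
    · exact hγ.exists_logarithmicSojourn_of_stronglyConcaveNear h.toDampedSystem hconc hc
  · exact hγ.exists_logarithmicSojourn_of_deriv_ne_zero h hc

theorem exists_logarithmicSojourn_sublevel (hγ : IsTrajectory a G γ)
    (h : SlowlyDampedSystem a G) (hlim : Tendsto (fun t => energy G (γ t)) atTop (𝓝 e))
    (hv : ¬ Tendsto (fun t => (γ t).2) atTop (𝓝 0)) :
    ∃ μ > 0, LogarithmicSojourn G γ e {y | |G y - e| < μ} := by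
  obtain ⟨R, hR⟩ := hγ.exists_norm_le h.toDampedSystem
  have hlocal : ∀ y, ∃ U ∈ 𝓝 y, G y = e → LogarithmicSojourn G γ e U := fun y => by
    by_cases hy : G y = e
    · subst hy
      obtain ⟨U, hU, hsoj⟩ := hγ.exists_logarithmicSojourn_of_not_tendsto h hlim hv
      exact ⟨U, hU, fun _ => hsoj⟩
    · exact ⟨univ, univ_mem, fun hy' => absurd hy' hy⟩
  choose U hU hsoj using hlocal
  obtain ⟨A, hA, μ, hμ, hcover⟩ := exists_isPreconnected_subset_of_abs_sub_lt
    (isCompact_closedBall (0 : ℝ) R) h.contDiff.continuous (e := e)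
    (fun y _ hy => hy ▸ h.eventually_ne y) fun y _ _ => hU y
  choose! C hC hbound using fun y (hy : G y = e) => hsoj y hy
  have hC0 : ∀ y ∈ A, 0 ≤ C y := fun y hy => hC y (hA y hy)
  refine ⟨μ, hμ, ∑ y ∈ A, C y, A.sum_nonneg hC0, ?_⟩
  filter_upwards [(eventually_all_finset A).2 fun y hy => hbound y (hA y hy),
    eventually_ge_atTop 0] with t hstay ht s hts hμs hes
  have hcont : ContinuousOn (fun r => (γ r).1) (Ici 0) := hγ.continuousOn.fst
  obtain ⟨y, hy, hyU⟩ := hcover ((fun r => (γ r).1) '' Icc t s)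
    (image_subset_iff.2 fun r hr => mem_closedBall_zero_iff.2
      ((norm_fst_le _).trans (hR r (ht.trans hr.1))))
    (isPreconnected_Icc.image _ (hcont.mono fun r hr => ht.trans hr.1))
    ((nonempty_Icc.2 hts).image _) (forall_mem_image.2 hμs)
  refine (hstay y hy s hts (fun r hr => hyU (mem_image_of_mem _ hr)) hes).trans ?_
  have hlog := log_one_add_one_div_nonneg (sub_nonneg.2 hes.le)
  exact mul_le_mul_of_nonneg_right (A.single_le_sum hC0 hy) (by linarith)

theorem eventually_abs_sub_lt_of_abs_snd_le
    (hlim : Tendsto (fun t => energy G (γ t)) atTop (𝓝 e)) {μ : ℝ} (hμ : 0 < μ) :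
    ∀ᶠ t in atTop, |(γ t).2| ≤ √μ → |G (γ t).1 - e| < μ := by
  filter_upwards [hlim.eventually (Metric.ball_mem_nhds e (half_pos hμ))] with t ht hv
  rw [Real.dist_eq, abs_lt] at ht
  have hkinetic : (γ t).2 ^ 2 ≤ μ := by
    simpa only [sq_abs] using (Real.le_sqrt (abs_nonneg _) hμ.le).1 hv
  unfold energy at ht
  rw [abs_lt]
  constructor <;> linarith [ht.1, ht.2, sq_nonneg (γ t).2]

theorem tendsto_snd (hγ : IsTrajectory a G γ) (h : SlowlyDampedSystem a G) :
    Tendsto (fun t => (γ t).2) atTop (𝓝 0) := by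
  by_contra hv
  obtain ⟨e, hlim, he⟩ := hγ.exists_tendsto_energy h.toDampedSystem
  obtain ⟨μ, hμ, C, hC, hsoj⟩ := hγ.exists_logarithmicSojourn_sublevel h hlim hv
  obtain ⟨v, hv0, hfast⟩ : ∃ v > 0, ∃ᶠ t in atTop, v ≤ |(γ t).2| := by
    simpa [Metric.tendsto_nhds, frequently_atTop] using hv
  obtain ⟨τ, hτ, κ, hκ, hdrop⟩ := hγ.exists_energy_add_le h (v := min v √μ) (by positivity)
  refine not_eventually_exists_logarithmic_loss (e := fun t => energy G (γ t) - e)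
    (fun t ht => sub_nonneg.2 (he t ht))
    (fun r hr s hs hrs => sub_le_sub_right (hγ.antitoneOn_energy h.toDampedSystem hr hs hrs) e)
    hC hκ hτ ?_
  filter_upwards [hsoj, eventually_forall_ge_atTop.2 (eventually_abs_sub_lt_of_abs_snd_le hlim hμ),
    eventually_ge_atTop 1] with t hsoj hlevel ht
  have hcont : ContinuousOn (fun r => (γ r).2) (Ici 0) := hγ.continuousOn.snd
  obtain ⟨r, htr, hr⟩ := frequently_atTop.1 hfast t
  obtain ⟨s, hts, hvs, hfirst⟩ := exists_ge_le_and_eq_or_forall_le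
    (hcont.abs.mono (Ici_subset_Ici.2 (zero_le_one.trans ht))) ⟨r, htr, (min_le_left v √μ).trans hr⟩
  have hloss := hdrop s (ht.trans hts) hvs
  have hes : e < energy G (γ s) := by
    have : 0 < κ / s := div_pos hκ (by linarith)
    linarith [he (s + τ) (by linarith)]
  refine ⟨s, hts, ?_, by linarith⟩
  rcases hfirst with rfl | hslow
  · rw [sub_self]
    have hlog := log_one_add_one_div_nonneg (sub_nonneg.2 hes.le)
    positivity
  · exact hsoj s hts (fun r hr => hlevel r hr.1 ((hslow r hr).trans (min_le_right v √μ))) hes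

theorem exists_tendsto (hγ : IsTrajectory a G γ) (h : SlowlyDampedSystem a G) :
    ∃ c, deriv G c = 0 ∧ Tendsto γ atTop (𝓝 (c, 0)) := by
  have hv := hγ.tendsto_snd h
  obtain ⟨e, hlim, -⟩ := hγ.exists_tendsto_energy h.toDampedSystem
  obtain ⟨R, hR⟩ := hγ.exists_norm_le h.toDampedSystem
  have hpotential : Tendsto (fun t => G (γ t).1) atTop (𝓝 e) := by
    simpa [energy] using hlim.sub ((hv.pow 2).div_const 2)
  have hcont : ContinuousOn (fun t => (γ t).1) (Ici 0) := hγ.continuousOn.fst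
  obtain ⟨c, hx⟩ := exists_tendsto_of_tendsto_comp (isCompact_closedBall (0 : ℝ) R)
    h.contDiff.continuous (fun y _ hy => hy ▸ h.eventually_ne y) hcont
    (fun t ht => mem_closedBall_zero_iff.2 ((norm_fst_le _).trans (hR t ht))) hpotential
  refine ⟨c, ?_, hx.prodMk_nhds hv⟩
  have hforce : Tendsto (fun t => -(a t * (γ t).2) - deriv G (γ t).1) atTop
      (𝓝 (-0 - deriv G c)) :=
    (hγ.tendsto_friction h).neg.sub ((h.continuous_deriv.tendsto c).comp hx)
  simpa using eq_zero_of_tendsto_of_tendsto_deriv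
    ((eventually_gt_atTop 0).mono fun t ht => hγ.hasDerivAt_snd ht) hv hforce

end IsTrajectory

end Asymptotics

section Genericity

variable {a G : ℝ → ℝ} {c T : ℝ}

theorem exists_lt_abs_of_le_mul_deriv {z w : ℝ → ℝ} {κ : ℝ}
    (hz : ∀ t, T ≤ t → HasDerivAt z (w t) t) (hκ : 0 < κ) (hzw : ∀ t, T ≤ t → κ ≤ z t * w t)
    (B : ℝ) : ∃ t ≥ T, B < |z t| := by
  have hsq : ∀ t, T ≤ t → HasDerivAt (fun r => z r ^ 2) (2 * (z t * w t)) t := fun t ht =>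
    ((hz t ht).fun_pow 2).congr_deriv (by push_cast; ring)
  refine ⟨T + (B ^ 2 + 1) / (2 * κ), le_add_of_nonneg_right (by positivity),
    abs_lt_of_sq_lt_sq' ?_ (abs_nonneg _) |>.2⟩
  have hgrowth := (convex_Ici T).mul_sub_le_image_sub_of_le_deriv
    (fun t ht => (hsq t ht).continuousAt.continuousWithinAt)
    (fun t ht => (hsq t (interior_subset ht)).differentiableAt.differentiableWithinAt)
    (C := 2 * κ) (fun t ht => by
      rw [(hsq t (interior_subset ht)).deriv]
      linarith [hzw t (interior_subset ht)])
    T self_mem_Ici (T + (B ^ 2 + 1) / (2 * κ)) (mem_Ici.2 <| le_add_of_nonneg_right (by positivity))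
    (le_add_of_nonneg_right (by positivity))
  rw [add_sub_cancel_left, mul_div_cancel₀ _ (by positivity)] at hgrowth
  rw [sq_abs]
  linarith [sq_nonneg (z T)]

theorem exists_lt_abs_of_nonneg_sq_add_mul {z w w' : ℝ → ℝ}
    (hz : ∀ t, T ≤ t → HasDerivAt z (w t) t) (hw : ∀ t, T ≤ t → HasDerivAt w (w' t) t)
    (hnonneg : ∀ t, T ≤ t → 0 ≤ w t ^ 2 + z t * w' t) (hT : 0 < z T * w T) (B : ℝ) :
    ∃ t ≥ T, B < |z t| := by
  have hzw : ∀ t, T ≤ t → HasDerivAt (fun r => z r * w r) (w t ^ 2 + z t * w' t) t := fun t ht =>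
    ((hz t ht).fun_mul (hw t ht)).congr_deriv (by ring)
  have hmono : MonotoneOn (fun t => z t * w t) (Ici T) :=
    monotoneOn_of_hasDerivWithinAt_nonneg (convex_Ici T)
      (fun t ht => (hzw t ht).continuousAt.continuousWithinAt)
      (fun t ht => (hzw t (interior_subset ht)).hasDerivWithinAt)
      fun t ht => hnonneg t (interior_subset ht)
  exact exists_lt_abs_of_le_mul_deriv hz hT (fun t ht => hmono self_mem_Ici ht ht) B

theorem StronglyConcaveNear.exists_eventually_not_mapsTo_closedBall (hG : StronglyConcaveNear G c)
    (ha : Tendsto a atTop (𝓝 0)) :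
    ∃ ρ > 0, ∀ᶠ T in atTop, ∀ γ η, IsTrajectory a G γ → IsTrajectory a G η →
      0 < ((η T).1 - (γ T).1) * ((η T).2 - (γ T).2) →
      MapsTo (fun t => (γ t).1) (Ici T) (Metric.closedBall c ρ) →
      ¬ MapsTo (fun t => (η t).1) (Ici T) (Metric.closedBall c ρ) := by
  obtain ⟨δ, hδ, hconc⟩ := hG.exists_eventually_mul_sub_le
  obtain ⟨ρ, hρ, hball⟩ := (Metric.nhds_basis_closedBall.prod_self).mem_iff.1 hconc
  have hsmall : ∀ᶠ t in atTop, a t ^ 2 ≤ 8 * δ :=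
    (ha.pow 2).eventually_le_const (by rw [zero_pow two_ne_zero]; positivity)
  refine ⟨ρ, hρ, ?_⟩
  filter_upwards [eventually_forall_ge_atTop.2 hsmall, eventually_gt_atTop 0] with
    T ha hT γ η hγ hη hsep hγ_ball hη_ball
  have hnonneg : ∀ t, T ≤ t → 0 ≤ ((η t).2 - (γ t).2) ^ 2 + ((η t).1 - (γ t).1) *
      ((-(a t * (η t).2) - deriv G (η t).1) - (-(a t * (γ t).2) - deriv G (γ t).1)) := by
    intro t ht
    have hforce : (deriv G (η t).1 - deriv G (γ t).1) * ((η t).1 - (γ t).1) ≤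
        -(2 * δ * ((η t).1 - (γ t).1) ^ 2) :=
      hball (mk_mem_prod (hγ_ball ht) (hη_ball ht))
    nlinarith [sq_nonneg ((η t).2 - (γ t).2 - a t * ((η t).1 - (γ t).1) / 2),
      mul_le_mul_of_nonneg_right (ha t ht) (sq_nonneg ((η t).1 - (γ t).1))]
  obtain ⟨t, ht, hlt⟩ := exists_lt_abs_of_nonneg_sq_add_mul
    (fun t ht => (hη.hasDerivAt_fst (hT.trans_le ht)).sub (hγ.hasDerivAt_fst (hT.trans_le ht)))
    (fun t ht => (hη.hasDerivAt_snd (hT.trans_le ht)).sub (hγ.hasDerivAt_snd (hT.trans_le ht)))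
    hnonneg hsep (ρ + ρ)
  exact hlt.not_ge ((dist_triangle_right _ _ c).trans (add_le_add (hη_ball ht) (hγ_ball ht)))

namespace DampedSystem

/-- The initial data at time `0` whose trajectory has its position in `S` from time `T` on. -/
def trappedData (h : DampedSystem a G) (S : Set ℝ) (T : ℝ) : Set (ℝ × ℝ) :=
  {p | MapsTo (fun t => (h.trajectory le_rfl p t).1) (Ici T) S}

theorem isClosed_trappedData (h : DampedSystem a G) {S : Set ℝ} (hS : IsClosed S) (hT : 0 ≤ T) :
    IsClosed (h.trappedData S T) := by
  have hinter : h.trappedData S T =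
      ⋂ t ∈ Ici T, (fun p => (h.trajectory le_rfl p t).1) ⁻¹' S := by
    ext p
    simp [trappedData, MapsTo]
  rw [hinter]
  exact isClosed_biInter fun t ht =>
    hS.preimage (h.continuous_trajectory le_rfl (hT.trans ht)).fst

theorem exists_eventually_interior_trappedData_eq_empty (h : DampedSystem a G)
    (ha : Tendsto a atTop (𝓝 0)) (hG : StronglyConcaveNear G c) :
    ∃ ρ > 0, ∀ᶠ T in atTop, interior (h.trappedData (Metric.closedBall c ρ) T) = ∅ := by
  obtain ⟨ρ, hρ, hsep⟩ := hG.exists_eventually_not_mapsTo_closedBall ha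
  refine ⟨ρ, hρ, ?_⟩
  filter_upwards [hsep, eventually_ge_atTop 0] with T hsep hT
  refine eq_empty_iff_forall_notMem.2 fun p hp => ?_
  set γ := h.trajectory le_rfl p
  have hγ : IsTrajectory a G γ := h.isTrajectory_trajectory le_rfl p
  have hback : h.trajectory hT (γ T) 0 = p :=
    (h.eqOn_trajectory hγ hT self_mem_Ici).symm.trans (h.trajectory_self le_rfl p)
  have hperturb : Tendsto (fun s : ℝ => h.trajectory hT (γ T + (s, s)) 0) (𝓝[>] 0) (𝓝 p) := by
    have hcont : Continuous fun s : ℝ => h.trajectory hT (γ T + (s, s)) 0 :=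
      (h.continuous_trajectory hT le_rfl).comp (by fun_prop)
    have hlim := hcont.tendsto 0
    rw [Prod.mk_zero_zero, add_zero, hback] at hlim
    exact hlim.mono_left nhdsWithin_le_nhds
  obtain ⟨s, hmem, hs⟩ :=
    ((hperturb.eventually_mem (mem_interior_iff_mem_nhds.1 hp)).and self_mem_nhdsWithin).exists
  set η := h.trajectory hT (γ T + (s, s))
  have hη : IsTrajectory a G η := h.isTrajectory_trajectory hT _
  refine hsep γ η hγ hη ?_ (interior_subset hp) fun t ht => ?_
  · rw [show η T = γ T + (s, s) from h.trajectory_self hT _]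
    simpa using mul_pos hs hs
  · simpa only [h.eqOn_trajectory hη le_rfl (hT.trans ht)] using hmem ht

theorem eventually_residual_not_tendsto (h : DampedSystem a G) (ha : Tendsto a atTop (𝓝 0)) :
    ∀ᶠ p in residual (ℝ × ℝ), ∀ c, StronglyConcaveNear G c →
      ¬ Tendsto (fun t => (h.trajectory le_rfl p t).1) atTop (𝓝 c) := by
  have htrap := fun c (hc : StronglyConcaveNear G c) =>
    h.exists_eventually_interior_trappedData_eq_empty ha hc
  choose! ρ hρ hinterior using htrap
  obtain ⟨D, hDS, hD, hcover⟩ := TopologicalSpace.countable_cover_nhdsWithin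
    (s := {c | StronglyConcaveNear G c}) (f := fun c => Metric.ball c (ρ c))
    fun c hc => mem_nhdsWithin_of_mem_nhds (Metric.ball_mem_nhds c (hρ c hc))
  have hnot_trapped : ∀ᶠ p in residual (ℝ × ℝ), ∀ c ∈ D, ∀ n : ℕ,
      interior (h.trappedData (Metric.closedBall c (ρ c)) n) = ∅ →
      p ∉ h.trappedData (Metric.closedBall c (ρ c)) n := by
    rw [eventually_countable_ball hD]
    refine fun c _ => eventually_countable_forall.2 fun n =>
      eventually_imp_distrib_left.2 fun hempty => ?_
    exact residual_of_dense_open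
      (h.isClosed_trappedData Metric.isClosed_closedBall n.cast_nonneg).isOpen_compl
      (interior_eq_empty_iff_dense_compl.1 hempty)
  filter_upwards [hnot_trapped] with p hp c hc hlim
  obtain ⟨d, hd, hcd⟩ := mem_iUnion₂.1 (hcover hc)
  have hball : ∀ᶠ t in atTop, (h.trajectory le_rfl p t).1 ∈ Metric.closedBall d (ρ d) :=
    (hlim.eventually (Metric.isOpen_ball.mem_nhds hcd)).mono fun _ =>
      fun hx => Metric.ball_subset_closedBall hx
  obtain ⟨n, hstay, hempty⟩ := (tendsto_natCast_atTop_atTop.eventually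
    ((eventually_forall_ge_atTop.2 hball).and (hinterior d (hDS hd)))).exists
  exact hp d hd n hempty hstay

end DampedSystem

namespace SlowlyDampedSystem

theorem eventually_exists_tendsto_isLocalMin (h : SlowlyDampedSystem a G)
    (hG : StronglyConvexNear G c) (hc : deriv G c = 0) :
    ∀ᶠ w in 𝓝 (c, 0), ∀ γ, IsTrajectory a G γ → ∀ T, 0 ≤ T → γ T = w →
      ∃ m, IsLocalMin G m ∧ Tendsto (fun t => (γ t).1) atTop (𝓝 m) := by
  obtain ⟨δ, hδ, hle⟩ := hG.exists_eventually_le hc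
  obtain ⟨ρ, hρ, hball⟩ :=
    Metric.nhds_basis_closedBall.mem_iff.1 (hle.and hG.eventually_nhds)
  have hsphere : ∀ y ∈ Metric.sphere c ρ, G c + δ * ρ ^ 2 ≤ G y := fun y hy => by
    rw [← mem_sphere_iff_norm.1 hy, Real.norm_eq_abs, sq_abs]
    exact (hball (Metric.sphere_subset_closedBall hy)).1
  have hposition : ∀ᶠ w : ℝ × ℝ in 𝓝 (c, 0), dist w.1 c < ρ :=
    (continuous_fst.tendsto (c, 0)).eventually_mem (Metric.ball_mem_nhds c hρ)
  have henergy : ∀ᶠ w in 𝓝 (c, 0), energy G w < G c + δ * ρ ^ 2 := by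
    refine h.continuous_energy.continuousAt.eventually_lt_const ?_
    simp only [energy]
    nlinarith [mul_pos hδ (sq_pos_of_pos hρ)]
  filter_upwards [hposition, henergy]
  rintro _ hx hE γ hγ T hT rfl
  have htrap := hγ.dist_fst_lt_of_energy_lt h.toDampedSystem hsphere hT hx hE
  obtain ⟨m, hm, hlim⟩ := hγ.exists_tendsto h
  have hmem : m ∈ Metric.closedBall c ρ := Metric.isClosed_closedBall.mem_of_tendsto hlim.fst_nhds
    ((eventually_ge_atTop T).mono fun t ht => (htrap t ht).le)
  exact ⟨m, (hball hmem).2.isLocalMin hm, hlim.fst_nhds⟩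

theorem isOpen_dataConvergingToLocalMin (h : SlowlyDampedSystem a G) :
    IsOpen (dataConvergingToLocalMin a G) := by
  refine isOpen_iff_eventually.2 fun p hp => ?_
  obtain ⟨m, hmin, hx⟩ := h.mem_dataConvergingToLocalMin_iff.1 hp
  have hm : deriv G m = 0 := hmin.deriv_eq_zero
  have hG : StronglyConvexNear G m :=
    (h.nondegenerate m hm).resolve_right fun hconc => hconc.not_isLocalMin hm hmin
  have hlim : Tendsto (h.trajectory le_rfl p) atTop (𝓝 (m, 0)) :=
    hx.prodMk_nhds ((h.isTrajectory_trajectory le_rfl p).tendsto_snd h)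
  obtain ⟨T, hbasin, hT⟩ := ((hlim.eventually (eventually_eventually_nhds.2
    (h.eventually_exists_tendsto_isLocalMin hG hm))).and (eventually_ge_atTop 0)).exists
  filter_upwards [(h.continuous_trajectory le_rfl hT).continuousAt.eventually hbasin] with q hq
  exact h.mem_dataConvergingToLocalMin_iff.2
    (hq _ (h.isTrajectory_trajectory le_rfl q) T hT rfl)

theorem dense_dataConvergingToLocalMin (h : SlowlyDampedSystem a G) :
    Dense (dataConvergingToLocalMin a G) := by
  refine (dense_of_mem_residual (h.eventually_residual_not_tendsto h.tendsto_zero)).mono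
    fun p hp => h.mem_dataConvergingToLocalMin_iff.2 ?_
  obtain ⟨c, hc, hlim⟩ := (h.isTrajectory_trajectory le_rfl p).exists_tendsto h
  rcases h.nondegenerate c hc with hconv | hconc
  · exact ⟨c, hconv.isLocalMin hc, hlim.fst_nhds⟩
  · exact absurd hlim.fst_nhds (hp c hconc)

end SlowlyDampedSystem

end Genericity

theorem exists_forall_le_of_continuousOn_Ici_of_tendsto {f : ℝ → ℝ} {s l : ℝ}
    (hf : ContinuousOn f (Ici s)) (hlim : Tendsto f atTop (𝓝 l)) :
    ∃ A, ∀ t, s ≤ t → f t ≤ A := by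
  obtain ⟨T, hT⟩ := eventually_atTop.1 (hlim.eventually_le_const (lt_add_one l))
  obtain ⟨B, hB⟩ := (isCompact_Icc (a := s) (b := T)).bddAbove_image
    (hf.mono Icc_subset_Ici_self)
  refine ⟨max B (l + 1), fun t hst => ?_⟩
  rcases le_total t T with htT | hTt
  · exact le_max_of_le_left (hB (mem_image_of_mem f ⟨hst, htT⟩))
  · exact le_max_of_le_right (hT t hTt)

theorem mainTheorem2_general (a G : ℝ → ℝ)
    (ha_cont : ContinuousOn a (Ici 0))
    (ha_lim : Tendsto a atTop (𝓝 0))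
    (ha_lower : ∃ c > 0, ∀ t, 0 ≤ t → c / (t + 1) ≤ a t)
    (hG_C1 : ContDiff ℝ 1 G)
    (hG_coercive : Tendsto G (cocompact ℝ) atTop)
    (hG_lip : ∀ s : Set ℝ, Bornology.IsBounded s → ∃ K, LipschitzOnWith K (deriv G) s)
    (hG_conv : ∀ c, deriv G c = 0 → StronglyConvexNear G c ∨ StronglyConcaveNear G c) :
    (∀ p : ℝ × ℝ, ∃ x, IsSolutionFrom a G p x ∧
      ∀ y, IsSolutionFrom a G p y → EqOn y x (Ici 0)) ∧
    IsOpen (dataConvergingToLocalMin a G) ∧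
    Dense (dataConvergingToLocalMin a G) := by
  have ha_nonneg : ∀ t, 0 ≤ t → 0 ≤ a t := fun t ht =>
    let ⟨_, hc, hle⟩ := ha_lower
    (div_nonneg hc.le (add_nonneg ht zero_le_one)).trans (hle t ht)
  have h : SlowlyDampedSystem a G :=
    { continuousOn := ha_cont
      nonneg := ha_nonneg
      bounded := exists_forall_le_of_continuousOn_Ici_of_tendsto ha_cont ha_lim
      contDiff := hG_C1
      coercive := hG_coercive
      lipschitz := hG_lip
      tendsto_zero := ha_lim
      exists_le := ha_lower
      nondegenerate := hG_conv }
  exact ⟨fun p => ⟨_, h.isSolutionFrom_trajectory p, fun _ => h.eqOn_fst_trajectory⟩,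
    h.isOpen_dataConvergingToLocalMin, h.dense_dataConvergingToLocalMin⟩

theorem mainTheorem2 (a G : ℝ → ℝ)
    (ha_nonneg : ∀ t, 0 ≤ t → 0 ≤ a t)
    (ha_diff : DifferentiableOn ℝ a (Ici 0))
    (ha_anti : AntitoneOn a (Ici 0))
    (ha_lim : Tendsto a atTop (𝓝 0))
    (ha_lower : ∃ c > 0, ∀ t, 0 ≤ t → c / (t + 1) ≤ a t)
    (hG_C1 : ContDiff ℝ 1 G)
    (hG_coercive : Tendsto G (cocompact ℝ) atTop)
    (hG_lip : ∀ s : Set ℝ, Bornology.IsBounded s → ∃ K, LipschitzOnWith K (deriv G) s)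
    (hG_finite : {c | deriv G c = 0}.Finite)
    (hG_inj : InjOn G {c | deriv G c = 0})
    (hG_conv : ∀ c, deriv G c = 0 → StronglyConvexNear G c ∨ StronglyConcaveNear G c) :
    (∀ p : ℝ × ℝ, ∃ x, IsSolutionFrom a G p x ∧
      ∀ y, IsSolutionFrom a G p y → EqOn y x (Ici 0)) ∧
    IsOpen (dataConvergingToLocalMin a G) ∧
    Dense (dataConvergingToLocalMin a G) :=
  mainTheorem2_general a G ha_diff.continuousOn ha_lim ha_lower hG_C1 hG_coercive hG_lip hG_conv
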